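/- Fix a grading datum: an abelian group $\Gamma$, an element $\mathbf 1\in\Gamma$ (written $1$ in degrees), and a symmetric bilinear form $\sigma:\Gamma\times\Gamma\to\mathbb Z/2$ with $\sigma(\mathbf 1,\mathbf 1)=1$; put $(-1)^a=(-1)^{\sigma(\mathbf 1,a)}$. Complexes are $\Gamma$-graded with differentials of degree $\mathbf 1$. A DG-category is a category enriched in such complexes, and $Z^0(\mathbf E)$, $H^0(\mathbf E)$ denote the categories with the same objects whose morphisms are the closed morphisms of degree $0$, respectively the degree $0$ cohomology classes. If $\mathbf E$ is an additive DG-category with shifts and cones, then $H^0(\mathbf E)$ is triangulated. For a DG-category $\mathbf E$ let $\mathbf E^\flat$ be the DG-category whose objects are pairs $(X,\sigma_X)$ with $X\in\mathbf E$, $\sigma_X\in\mathrm{Hom}^{-1}_{\mathbf E}(X,X)$, $d(\sigma_X)=\mathrm{id}_X$, $\sigma_X^2=0$; whose group $\mathrm{Hom}^i$ consists of the closed morphisms $f:X\to Y$ of degree $-i$ in $\mathbf E$, with composition as in $\mathbf E$; and whose differential is $d^\flat(f)=\sigma_Yf-(-1)^if\sigma_X$. Let $\Phi:Z^0(\mathbf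 E)\to Z^0(\mathbf E^\flat)$ be the functor $A\mapsto\mathrm{cone}(\mathrm{id}_{A[-1]})$ with its canonical contracting homotopy (namely, $\iota'\pi'$, where $\mathrm{cone}(\mathrm{id}_{A[-1]})=E$ is given by $\iota\in\mathrm{Hom}^1(A,E)$, $\iota'\in\mathrm{Hom}^0(A,E)$, $\pi\in\mathrm{Hom}^0(E,A)$, $\pi'\in\mathrm{Hom}^{-1}(E,A)$ with $\pi'\iota=\mathrm{id}=\pi\iota'$, $\pi\iota=0=\pi'\iota'$, $\iota\pi'+\iota'\pi=\mathrm{id}_E$, $d\iota=0=d\pi$, $d\iota'=\iota$, $d\pi'=\pi$), and let $\Psi^+:Z^0(\mathbf E^\flat)\to Z^0(\mathbf E)$ be the functor $(X,\sigma_X)\mapsto X$. An exact DG-category is an additive DG-category $\mathbf E$ with shifts and cones together with Quillen exact structures on $Z^0(\mathbf E)$ and on $Z^0(\mathbf E^\flat)$, both preserved by the shifts $[1]$ and $[-1]$, such that $\Phi$ and $\Psi^+$ preserve and reflect admissible short exact sequences. It has exact coproducts (products) if all set-indexed coproducts (products) exist in the DG-category $\mathbf E$ and the coproduct (product) of any family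 of admissible short exact sequences in $Z^0(\mathbf E)$ is an admissible short exact sequence. An object $J\in\mathbf E$ is graded-injective (graded-projective) if the functor $\mathrm{Hom}(-,\Phi(J))$ (respectively $\mathrm{Hom}(\Phi(J),-)$) takes admissible short exact sequences in $Z^0(\mathbf E^\flat)$ to short exact sequences of abelian groups; $\mathbf E_{\mathrm{inj}}$, $\mathbf E_{\mathrm{proj}}\subset\mathbf E$ denote the full DG-subcategories of such objects. The totalization of a short exact sequence $A\xrightarrow{f}B\xrightarrow{g}C$ in $Z^0(\mathbf E)$ is the total object $A[1]\oplus B\oplus C[-1]$ of this three-term complex. If $\mathbf E$ has exact coproducts, $\mathrm{Ac}^{\mathrm{co}}(\mathbf E)$ (the coacyclic objects) is the minimal (strictly full) triangulated subcategory of $H^0(\mathbf E)$ that contains the totalizations of all admissible short exact sequences in $Z^0(\mathbf E)$ and is closed under coproducts in $H^0(\mathbf E)$; and $D^{\mathrm{co}}(\mathbf E)=H^0(\mathbf E)/\mathrm{Ac}^{\mathrm{co}}(\mathbf E)$ is the Verdier quotient. If $\mathbf E$ has exact products, $\mathrm{Ac}^{\mathrm{ctr}}(\mathbf E)$ (the contraacyclic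 objects) is defined in the same way with products in place of coproducts, and $D^{\mathrm{ctr}}(\mathbf E)=H^0(\mathbf E)/\mathrm{Ac}^{\mathrm{ctr}}(\mathbf E)$. **Theorem.** (a) Let $\mathbf E$ be an exact DG-category with exact coproducts. Then $\mathrm{Hom}_{H^0(\mathbf E)}(X,J)=0$ for all $J\in H^0(\mathbf E_{\mathrm{inj}})$ and $X\in\mathrm{Ac}^{\mathrm{co}}(\mathbf E)$. Consequently, $H^0(\mathbf E_{\mathrm{inj}})\to H^0(\mathbf E)$ being the inclusion of a full triangulated subcategory, its composition with the Verdier quotient functor $H^0(\mathbf E)\to D^{\mathrm{co}}(\mathbf E)$ is a fully faithful triangulated functor $H^0(\mathbf E_{\mathrm{inj}})\to D^{\mathrm{co}}(\mathbf E)$. (b) Let $\mathbf E$ be an exact DG-category with exact products. Then $\mathrm{Hom}_{H^0(\mathbf E)}(P,Y)=0$ for all $P\in H^0(\mathbf E_{\mathrm{proj}})$ and $Y\in\mathrm{Ac}^{\mathrm{ctr}}(\mathbf E)$. Consequently, $H^0(\mathbf E_{\mathrm{proj}})\to H^0(\mathbf E)$ being the inclusion of a full triangulated subcategory, its composition with the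 Verdier quotient functor $H^0(\mathbf E)\to D^{\mathrm{ctr}}(\mathbf E)$ is a fully faithful triangulated functor $H^0(\mathbf E_{\mathrm{proj}})\to D^{\mathrm{ctr}}(\mathbf E)$. -/

import Mathlib

open CategoryTheory CategoryTheory.Limits CategoryTheory.Pretriangulated

universe w t v u

/-- A grading group datum on an abelian group `Γ`: an element `one` and a symmetric bilinear form
`pairing : Γ × Γ → ℤ/2` with `pairing one one = 1`. -/
class GradingDatum (Γ : Type t) [AddCommGroup Γ] where
  one : Γ
  pairing : Γ →+ Γ →+ ZMod 2
  pairing_symm : ∀ a b, pairing a b = pairing b a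
  pairing_one_one : pairing one one = 1

namespace GradingDatum

variable {Γ : Type t} [AddCommGroup Γ] [GradingDatum Γ]

/-- The sign `(-1)^{pairing(one, a)}`. -/
def sgn (a : Γ) : ℤ := if pairing (one : Γ) a = 0 then 1 else -1

lemma sgn_add (a b : Γ) : sgn (a + b) = sgn a * sgn b := by
  have h : ∀ x y : ZMod 2, (if x + y = 0 then (1 : ℤ) else -1) =
      (if x = 0 then 1 else -1) * (if y = 0 then 1 else -1) := by decide
  simp only [sgn, map_add]
  exact h _ _

lemma sgn_zero : sgn (0 : Γ) = 1 := by simp [sgn]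

lemma sgn_one : sgn (one : Γ) = -1 := by simp [sgn, pairing_one_one]

lemma sgn_neg (a : Γ) : sgn (-a) = sgn a := by
  have h : ∀ x : ZMod 2, (if -x = 0 then (1 : ℤ) else -1) = (if x = 0 then 1 else -1) := by decide
  simp only [sgn, map_neg]
  exact h _

lemma sgn_mul_self (a : Γ) : sgn a * sgn a = 1 := by
  unfold sgn; split <;> simp

end GradingDatum

open GradingDatum

/-- The structure of a (`Γ`-graded) DG-category on a preadditive category `A`.
The group `X ⟶ Y` is the total group of the graded group of morphisms
(the direct sum of its components `hom X Y i`), and `d` is the differential of degree `one`. As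
`f ≫ g` is the composition `g ∘ f`, the last axiom is the usual Leibniz rule
`d (g ∘ f) = d g ∘ f + (-1)^{|g|} g ∘ d f`. -/
class DGCategory (Γ : Type t) [AddCommGroup Γ] [GradingDatum Γ]
    (A : Type u) [Category.{v} A] [Preadditive A] where
  hom (X Y : A) : Γ → AddSubgroup (X ⟶ Y)
  isInternal (X Y : A) : letI := Classical.decEq Γ; DirectSum.IsInternal (hom X Y)
  id_mem (X : A) : 𝟙 X ∈ hom X X 0
  comp_mem {X Y Z : A} {i j : Γ} {f : X ⟶ Y} {g : Y ⟶ Z} :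
    f ∈ hom X Y i → g ∈ hom Y Z j → f ≫ g ∈ hom X Z (i + j)
  d {X Y : A} : (X ⟶ Y) →+ (X ⟶ Y)
  d_mem {X Y : A} {i : Γ} {f : X ⟶ Y} : f ∈ hom X Y i → d f ∈ hom X Y (i + one)
  d_d {X Y : A} (f : X ⟶ Y) : d (d f) = 0
  leibniz {X Y Z : A} {j : Γ} (f : X ⟶ Y) (g : Y ⟶ Z) (hg : g ∈ hom Y Z j) :
    d (f ≫ g) = f ≫ d g + sgn j • (d f ≫ g)

namespace DG

open DGCategory

variable (Γ : Type t) [AddCommGroup Γ] [GradingDatum Γ]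

section Basic

variable {A : Type u} [Category.{v} A] [Preadditive A] [DGCategory Γ A]

variable {Γ} in
lemma comp_mem' {X Y Z : A} {i j k : Γ} {f : X ⟶ Y} {g : Y ⟶ Z}
    (hf : f ∈ hom X Y i) (hg : g ∈ hom Y Z j) (h : i + j = k) : f ≫ g ∈ hom X Z k :=
  h ▸ comp_mem hf hg

lemma d_id (X : A) : d Γ (𝟙 X) = 0 := by
  have h := leibniz (Γ := Γ) (𝟙 X) (𝟙 X) (id_mem X)
  simpa [sgn_zero] using h

variable {Γ} in
lemma hom_induction {X Y : A} {p : (X ⟶ Y) → Prop} (f : X ⟶ Y) (h0 : p 0)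
    (hadd : ∀ f g, p f → p g → p (f + g)) (h : ∀ (i : Γ) (f), f ∈ hom X Y i → p f) : p f := by
  classical
  obtain ⟨x, rfl⟩ := (isInternal (Γ := Γ) X Y).2 f
  induction x using DirectSum.induction_on with
  | zero => simpa using h0
  | of i x => simpa using h i _ x.2
  | add x y hx hy => simpa using hadd _ _ hx hy


/-- The group of closed morphisms of degree `0`. -/
def cocycles (X Y : A) : AddSubgroup (X ⟶ Y) := hom X Y (0 : Γ) ⊓ (d Γ (X := X) (Y := Y)).ker

/-- The subgroup of coboundaries of elements of degree `-1`. -/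
def coboundaries (X Y : A) : AddSubgroup (X ⟶ Y) := (hom X Y (-one : Γ)).map (d Γ)

variable {Γ}

lemma id_mem_cocycles (X : A) : 𝟙 X ∈ cocycles Γ X X := ⟨id_mem X, d_id Γ X⟩

lemma comp_mem_cocycles {X Y Z : A} {f : X ⟶ Y} {g : Y ⟶ Z} (hf : f ∈ cocycles Γ X Y)
    (hg : g ∈ cocycles Γ Y Z) : f ≫ g ∈ cocycles Γ X Z := by
  refine ⟨comp_mem' hf.1 hg.1 (add_zero 0), ?_⟩
  have h1 : d Γ f = 0 := hf.2
  have h2 : d Γ g = 0 := hg.2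
  simp [leibniz f g hg.1, h1, h2]

/-- `Y` is the shift of `X` by `[i]`: the data of mutually inverse closed morphisms
`X ⟶ Y` of degree `-i` and `Y ⟶ X` of degree `i`. -/
structure ShiftData (X : A) (i : Γ) where
  obj : A
  s : X ⟶ obj
  t : obj ⟶ X
  s_mem : s ∈ hom X obj (-i)
  t_mem : t ∈ hom obj X i
  s_t : s ≫ t = 𝟙 X
  t_s : t ≫ s = 𝟙 obj
  d_s : d Γ s = 0

/-- A cone of a closed morphism `f : X ⟶ Y` of degree `0`: an object decomposed
as `X[1] ⊕ Y` by maps of degrees `∓1` and `0`, such that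
the differentials of the injections are `d inl = inr ∘ f` and `d inr = 0`. This
says that `Hom(Z, obj)` is the cone of `Hom(Z, X) ⟶ Hom(Z, Y)`, naturally in `Z`. -/
structure ConeData (Γ : Type t) [AddCommGroup Γ] [GradingDatum Γ] [DGCategory Γ A]
    {X Y : A} (f : X ⟶ Y) where
  obj : A
  inl : X ⟶ obj
  inr : Y ⟶ obj
  fst : obj ⟶ X
  snd : obj ⟶ Y
  inl_mem : inl ∈ hom X obj (-one : Γ)
  inr_mem : inr ∈ hom Y obj (0 : Γ)
  fst_mem : fst ∈ hom obj X (one : Γ)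
  snd_mem : snd ∈ hom obj Y (0 : Γ)
  inl_fst : inl ≫ fst = 𝟙 X
  inr_snd : inr ≫ snd = 𝟙 Y
  inl_snd : inl ≫ snd = 0
  inr_fst : inr ≫ fst = 0
  total : fst ≫ inl + snd ≫ inr = 𝟙 obj
  d_inl : d Γ inl = f ≫ inr
  d_inr : d Γ inr = 0

end Basic

section Categories

variable (A : Type u) [Category.{v} A] [Preadditive A] [DGCategory Γ A]

/-- The category `Z⁰(A)`: its morphisms are the closed morphisms of degree `0`. -/
structure Z0 (Γ : Type t) (A : Type u) where
  obj : A

instance : Category.{v} (Z0 Γ A) where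
  Hom X Y := cocycles Γ X.obj Y.obj
  id X := ⟨𝟙 X.obj, id_mem_cocycles X.obj⟩
  comp f g := ⟨f.1 ≫ g.1, comp_mem_cocycles f.2 g.2⟩

variable {Γ A} in
/-- The underlying morphism in `A` of a morphism in `Z⁰(A)`. -/
def Z0.val {X Y : Z0 Γ A} (f : X ⟶ Y) : X.obj ⟶ Y.obj := f.1

instance : Preadditive (Z0 Γ A) where
  homGroup X Y := inferInstanceAs (AddCommGroup (cocycles Γ X.obj Y.obj))
  add_comp _ _ _ f g h := Subtype.ext (Preadditive.add_comp _ _ _ f.1 g.1 h.1)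
  comp_add _ _ _ f g h := Subtype.ext (Preadditive.comp_add _ _ _ f.1 g.1 h.1)

/-- The category `H⁰(A)`: its groups of morphisms are the groups `H⁰` of the complexes of
morphisms in `A`. -/
structure H0 (Γ : Type t) (A : Type u) where
  obj : A

variable {Γ A}

/-- The group `H⁰ Hom(X, Y)`. -/
abbrev H0.HomGroup (X Y : H0 Γ A) : Type v :=
  cocycles Γ X.obj Y.obj ⧸
    (coboundaries Γ X.obj Y.obj).addSubgroupOf (cocycles Γ X.obj Y.obj)

lemma comp_mem_coboundaries {X Y Z : A} {f : X ⟶ Y} {g : Y ⟶ Z} (hf : f ∈ cocycles Γ X Y)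
    (hg : g ∈ coboundaries Γ Y Z) : f ≫ g ∈ coboundaries Γ X Z := by
  obtain ⟨h, hh, rfl⟩ := hg
  refine ⟨f ≫ h, comp_mem' hf.1 hh (zero_add _), ?_⟩
  have h1 : d Γ f = 0 := hf.2
  simp [leibniz f h hh, h1]

lemma comp_mem_coboundaries' {X Y Z : A} {f : X ⟶ Y} {g : Y ⟶ Z} (hf : f ∈ coboundaries Γ X Y)
    (hg : g ∈ cocycles Γ Y Z) : f ≫ g ∈ coboundaries Γ X Z := by
  obtain ⟨h, hh, rfl⟩ := hf
  refine ⟨h ≫ g, comp_mem' hh hg.1 (add_zero _), ?_⟩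
  have h1 : d Γ g = 0 := hg.2
  simp [leibniz h g hg.1, h1, sgn_zero]

/-- Composition in `H⁰(A)`. -/
def H0.comp' {X Y Z : H0 Γ A} (f : HomGroup X Y) (g : HomGroup Y Z) : HomGroup X Z :=
  Quotient.map₂ (fun a b => (⟨a.1 ≫ b.1, comp_mem_cocycles a.2 b.2⟩ : cocycles Γ X.obj Z.obj))
    (fun a a' (ha : (QuotientAddGroup.leftRel _) a a') b b'
        (hb : (QuotientAddGroup.leftRel _) b b') => by
      rw [QuotientAddGroup.leftRel_apply, AddSubgroup.mem_addSubgroupOf] at ha hb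
      refine QuotientAddGroup.leftRel_apply.2 (AddSubgroup.mem_addSubgroupOf.2 ?_)
      have h := add_mem (comp_mem_coboundaries a.2 hb) (comp_mem_coboundaries' ha b'.2)
      simpa [Preadditive.comp_add, Preadditive.add_comp] using h) f g

instance : Category.{v} (H0 Γ A) where
  Hom X Y := H0.HomGroup X Y
  id X := QuotientAddGroup.mk ⟨𝟙 X.obj, id_mem_cocycles X.obj⟩
  comp f g := H0.comp' f g
  id_comp := by
    rintro X Y ⟨f⟩
    exact congrArg QuotientAddGroup.mk (Subtype.ext (Category.id_comp f.1))
  comp_id := by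
    rintro X Y ⟨f⟩
    exact congrArg QuotientAddGroup.mk (Subtype.ext (Category.comp_id f.1))
  assoc := by
    rintro X Y Z W ⟨f⟩ ⟨g⟩ ⟨h⟩
    exact congrArg QuotientAddGroup.mk (Subtype.ext (Category.assoc f.1 g.1 h.1))

instance : Preadditive (H0 Γ A) where
  homGroup X Y := inferInstanceAs (AddCommGroup (H0.HomGroup X Y))
  add_comp := by
    rintro X Y Z ⟨f⟩ ⟨g⟩ ⟨h⟩
    exact congrArg QuotientAddGroup.mk (Subtype.ext (Preadditive.add_comp _ _ _ f.1 g.1 h.1))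
  comp_add := by
    rintro X Y Z ⟨f⟩ ⟨g⟩ ⟨h⟩
    exact congrArg QuotientAddGroup.mk (Subtype.ext (Preadditive.comp_add _ _ _ f.1 g.1 h.1))

namespace H0

/-- The class in `H⁰(A)` of a closed morphism of degree `0`. -/
def cls {X Y : A} (f : X ⟶ Y) (hf : f ∈ cocycles Γ X Y) : (⟨X⟩ : H0 Γ A) ⟶ ⟨Y⟩ :=
  QuotientAddGroup.mk ⟨f, hf⟩

lemma cls_surjective {X Y : A} (φ : (⟨X⟩ : H0 Γ A) ⟶ ⟨Y⟩) : ∃ f hf, φ = cls f hf := by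
  obtain ⟨f⟩ := φ
  exact ⟨f.1, f.2, rfl⟩

lemma cls_id (X : A) : cls (𝟙 X) (id_mem_cocycles (Γ := Γ) X) = 𝟙 _ := rfl

lemma cls_comp {X Y Z : A} (f : X ⟶ Y) (hf : f ∈ cocycles Γ X Y) (g : Y ⟶ Z)
    (hg : g ∈ cocycles Γ Y Z) :
    cls f hf ≫ cls g hg = cls (f ≫ g) (comp_mem_cocycles hf hg) := rfl

lemma cls_add {X Y : A} (f : X ⟶ Y) (hf : f ∈ cocycles Γ X Y) (g : X ⟶ Y)
    (hg : g ∈ cocycles Γ X Y) :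
    cls f hf + cls g hg = cls (f + g) (add_mem hf hg) := rfl

lemma cls_neg {X Y : A} (f : X ⟶ Y) (hf : f ∈ cocycles Γ X Y) :
    -cls f hf = cls (-f) (neg_mem hf) := rfl

lemma cls_zero (X Y : A) : cls (0 : X ⟶ Y) (zero_mem (cocycles Γ X Y)) = 0 := rfl

lemma cls_congr {X Y : A} {f g : X ⟶ Y} (hf : f ∈ cocycles Γ X Y) (h : f = g) :
    cls f hf = cls g (h ▸ hf) := by subst h; rfl

lemma cls_eq_iff {X Y : A} {f g : X ⟶ Y} {hf : f ∈ cocycles Γ X Y} {hg : g ∈ cocycles Γ X Y} :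
    cls f hf = cls g hg ↔ ∃ h ∈ hom X Y (-one : Γ), d Γ h = g - f := by
  refine QuotientAddGroup.eq.trans (AddSubgroup.mem_addSubgroupOf.trans ?_)
  simp [coboundaries, sub_eq_neg_add]

end H0

lemma ShiftData.d_t {X : A} {i : Γ} (D : ShiftData X i) : d Γ D.t = 0 := by
  have h := leibniz D.s D.t D.t_mem
  rw [D.s_t, d_id, D.d_s] at h
  have h2 : D.t ≫ D.s ≫ d Γ D.t = 0 := by
    simp only [zero_comp, smul_zero, add_zero] at h
    rw [← h, comp_zero]
  rwa [← Category.assoc, D.t_s, Category.id_comp] at h2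

lemma ShiftData.s_t_assoc {X Z : A} {i : Γ} (D : ShiftData X i) (f : X ⟶ Z) :
    D.s ≫ D.t ≫ f = f := by
  rw [← Category.assoc, D.s_t, Category.id_comp]

lemma ShiftData.t_s_assoc {X Z : A} {i : Γ} (D : ShiftData X i) (f : D.obj ⟶ Z) :
    D.t ≫ D.s ≫ f = f := by
  rw [← Category.assoc, D.t_s, Category.id_comp]

attribute [simp] ShiftData.s_t ShiftData.t_s ShiftData.s_t_assoc ShiftData.t_s_assoc

lemma shift_mem {X Y : A} {i : Γ} (D : ShiftData X i) (E : ShiftData Y i) {f : X ⟶ Y}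
    (hf : f ∈ cocycles Γ X Y) : D.t ≫ f ≫ E.s ∈ cocycles Γ D.obj E.obj := by
  refine ⟨comp_mem' D.t_mem (comp_mem' hf.1 E.s_mem (zero_add _)) (add_neg_cancel _), ?_⟩
  have h1 : d Γ f = 0 := hf.2
  have h2 := comp_mem' hf.1 E.s_mem (zero_add _)
  simp [leibniz _ _ h2, leibniz _ _ E.s_mem, h1, D.d_t, E.d_s]

lemma shift_mem_coboundaries {X Y : A} {i : Γ} (D : ShiftData X i) (E : ShiftData Y i) {f : X ⟶ Y}
    (hf : f ∈ coboundaries Γ X Y) : D.t ≫ f ≫ E.s ∈ coboundaries Γ D.obj E.obj := by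
  obtain ⟨h, hh, rfl⟩ := hf
  have h2 := comp_mem' hh E.s_mem rfl
  refine ⟨sgn i • (D.t ≫ h ≫ E.s), zsmul_mem (comp_mem' D.t_mem h2 (by abel)) _, ?_⟩
  simp only [map_zsmul, leibniz _ _ h2, leibniz _ _ E.s_mem, D.d_t, E.d_s, sgn_neg]
  simp [smul_smul, sgn_mul_self]

lemma mem_cocycles_of {X Y Z : A} {i j : Γ} {f : X ⟶ Y} {g : Y ⟶ Z} (hf : f ∈ hom X Y i)
    (hg : g ∈ hom Y Z j) (h : i + j = 0) (df : d Γ f = 0) (dg : d Γ g = 0) :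
    f ≫ g ∈ cocycles Γ X Z := by
  refine ⟨comp_mem' hf hg h, ?_⟩
  simp [leibniz f g hg, df, dg]

lemma d_comp_zero {X Y Z : A} {j : Γ} {f : X ⟶ Y} {g : Y ⟶ Z}
    (hg : g ∈ hom Y Z j) (df : d Γ f = 0) (dg : d Γ g = 0) : d Γ (f ≫ g) = 0 := by
  simp [leibniz f g hg, df, dg]

lemma shift_comp_eq {X Y Z : A} {f : X ⟶ Y} {hf : f ∈ cocycles Γ X Y} {g : Y ⟶ Z}
    {hg : g ∈ cocycles Γ Y Z} {k : X ⟶ Z} {hk : k ∈ cocycles Γ X Z} (h : f ≫ g = k) :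
    H0.cls f hf ≫ H0.cls g hg = H0.cls k hk := by
  subst h; rfl

variable (Γ A)

/-- `A` is an additive DG-category with shifts and cones. -/
class HasShiftsAndCones : Prop where
  additive : HasFiniteCoproducts (Z0 Γ A)
  shift : ∀ (X : A) (i : Γ), Nonempty (ShiftData X i)
  cone : ∀ {X Y : A} (f : X ⟶ Y), f ∈ cocycles Γ X Y → Nonempty (ConeData Γ f)

section Cones

namespace ConeData

variable {Γ A}

attribute [simp] inl_fst inr_snd inl_snd inr_fst d_inr

variable {X Y Z : A} {f : X ⟶ Y} (C : ConeData Γ f)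

@[simp] lemma inl_fst_assoc (g : X ⟶ Z) : C.inl ≫ C.fst ≫ g = g := by
  rw [← Category.assoc, C.inl_fst, Category.id_comp]

@[simp] lemma inr_snd_assoc (g : Y ⟶ Z) : C.inr ≫ C.snd ≫ g = g := by
  rw [← Category.assoc, C.inr_snd, Category.id_comp]

@[simp] lemma inl_snd_assoc (g : Y ⟶ Z) : C.inl ≫ C.snd ≫ g = 0 := by
  rw [← Category.assoc, C.inl_snd, zero_comp]

@[simp] lemma inr_fst_assoc (g : X ⟶ Z) : C.inr ≫ C.fst ≫ g = 0 := by
  rw [← Category.assoc, C.inr_fst, zero_comp]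

lemma hom_ext {g h : C.obj ⟶ Z} (h₁ : C.inl ≫ g = C.inl ≫ h) (h₂ : C.inr ≫ g = C.inr ≫ h) :
    g = h := by
  rw [← Category.id_comp g, ← Category.id_comp h, ← C.total]
  simp [h₁, h₂]

@[simp] lemma d_fst : d Γ C.fst = 0 := by
  have h₁ := leibniz C.inl C.fst C.fst_mem
  have h₂ := leibniz C.inr C.fst C.fst_mem
  refine C.hom_ext ?_ ?_
  · simpa [d_id, C.d_inl] using h₁.symm
  · simpa using h₂.symm

@[simp] lemma d_snd : d Γ C.snd = -(C.fst ≫ f) := by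
  have h₁ := leibniz C.inl C.snd C.snd_mem
  have h₂ := leibniz C.inr C.snd C.snd_mem
  refine C.hom_ext ?_ ?_
  · simp [C.d_inl, sgn_zero] at h₁
    simpa using eq_neg_of_add_eq_zero_left h₁.symm
  · simpa [d_id] using h₂.symm

lemma inr_cocycle : C.inr ∈ cocycles Γ Y C.obj := ⟨C.inr_mem, C.d_inr⟩

end ConeData

variable {Γ A}

lemma oct_α_mem {X Y Z : A} {f : X ⟶ Y} {g : Y ⟶ Z} (hg : g ∈ cocycles Γ Y Z)
    (C : ConeData Γ f) (C'' : ConeData Γ (f ≫ g)) :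
    C.fst ≫ C''.inl + C.snd ≫ g ≫ C''.inr ∈ cocycles Γ C.obj C''.obj := by
  have dg : d Γ g = 0 := hg.2
  have m := comp_mem' hg.1 C''.inr_mem (add_zero _)
  refine ⟨add_mem (comp_mem' C.fst_mem C''.inl_mem (by abel)) (comp_mem' C.snd_mem m (by abel)), ?_⟩
  change d Γ _ = 0
  rw [map_add, leibniz _ _ C''.inl_mem, leibniz _ _ m, leibniz _ _ C''.inr_mem]
  simp [C''.d_inl, dg, sgn_zero]

lemma oct_β_mem {X Y Z : A} {f : X ⟶ Y} {g : Y ⟶ Z} (hf : f ∈ cocycles Γ X Y)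
    (C' : ConeData Γ g) (C'' : ConeData Γ (f ≫ g)) :
    C''.fst ≫ f ≫ C'.inl + C''.snd ≫ C'.inr ∈ cocycles Γ C''.obj C'.obj := by
  have df : d Γ f = 0 := hf.2
  have m := comp_mem' hf.1 C'.inl_mem (zero_add _)
  refine ⟨add_mem (comp_mem' C''.fst_mem m (by abel)) (comp_mem' C''.snd_mem C'.inr_mem (by abel)), ?_⟩
  change d Γ _ = 0
  rw [map_add, leibniz _ _ C'.inr_mem, leibniz _ _ m, leibniz _ _ C'.inl_mem]
  simp [C'.d_inl, df, sgn_zero]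

/-- An isomorphism in `H⁰(A)` from a homotopy equivalence. -/
def H0.homotopyIso {X Y : A} (f : X ⟶ Y) (g : Y ⟶ X) (hf : f ∈ cocycles Γ X Y)
    (hg : g ∈ cocycles Γ Y X) (h₁ : f ≫ g = 𝟙 X) (h : Y ⟶ Y) (hh : h ∈ hom Y Y (-one : Γ))
    (e : d Γ h = 𝟙 Y - g ≫ f) : (⟨X⟩ : H0 Γ A) ≅ ⟨Y⟩ where
  hom := cls f hf
  inv := cls g hg
  hom_inv_id := (cls_comp _ _ _ _).trans ((cls_congr _ h₁).trans (cls_id X))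
  inv_hom_id := (cls_comp _ _ _ _).trans ((cls_eq_iff.2 ⟨h, hh, e⟩).trans (cls_id Y))

end Cones

variable [HasShiftsAndCones Γ A]

instance : HasZeroObject (H0 Γ A) := by
  have : HasFiniteCoproducts (Z0 Γ A) := HasShiftsAndCones.additive
  have := HasFiniteBiproducts.of_hasFiniteCoproducts (C := Z0 Γ A)
  obtain ⟨Z, hZ⟩ := HasZeroObject.zero (C := Z0 Γ A)
  refine ⟨⟨Z.obj⟩, ?_⟩
  rw [IsZero.iff_id_eq_zero] at hZ ⊢
  exact congrArg QuotientAddGroup.mk hZ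

section Shift

variable {Γ A}

/-- A chosen shift of `X` by `[n]`, `n ∈ ℤ`. -/
noncomputable def sh (Γ : Type t) [AddCommGroup Γ] [GradingDatum Γ] [DGCategory Γ A]
    [HasShiftsAndCones Γ A] (X : A) (n : ℤ) : ShiftData X (n • (one : Γ)) :=
  (HasShiftsAndCones.shift X (n • (one : Γ))).some

/-- The map `f ↦ f[i]` on morphisms in `H⁰(A)`. -/
def shiftMap {X Y : A} {i : Γ} (D : ShiftData X i) (E : ShiftData Y i) :
    H0.HomGroup (⟨X⟩ : H0 Γ A) ⟨Y⟩ →+ H0.HomGroup (⟨D.obj⟩ : H0 Γ A) ⟨E.obj⟩ :=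
  QuotientAddGroup.map _ _
    (AddMonoidHom.mk' (fun f => ⟨D.t ≫ f.1 ≫ E.s, shift_mem D E f.2⟩)
      (fun f g => Subtype.ext (by simp)))
    (fun f hf => shift_mem_coboundaries D E hf)

/-- The shift functors on `H⁰(A)`. -/
noncomputable def shiftF (n : ℤ) : H0 Γ A ⥤ H0 Γ A where
  obj X := ⟨(sh Γ X.obj n).obj⟩
  map f := shiftMap (sh Γ _ n) (sh Γ _ n) f
  map_id X := by
    refine congrArg QuotientAddGroup.mk (Subtype.ext ?_)
    simp
  map_comp := by
    rintro X Y Z ⟨f⟩ ⟨g⟩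
    refine congrArg QuotientAddGroup.mk (Subtype.ext ?_)
    simp

lemma shiftF_map_cls {X Y : A} (n : ℤ) (f : X ⟶ Y) (hf : f ∈ cocycles Γ X Y) :
    (shiftF n).map (H0.cls f hf) = H0.cls _ (shift_mem (sh Γ X n) (sh Γ Y n) hf) := rfl

/-- An isomorphism in `H⁰(A)` from a strict one. -/
def H0.isoOf {X Y : A} (f : X ⟶ Y) (g : Y ⟶ X) (hf : f ∈ cocycles Γ X Y) (hg : g ∈ cocycles Γ Y X)
    (h₁ : f ≫ g = 𝟙 X) (h₂ : g ≫ f = 𝟙 Y) : (⟨X⟩ : H0 Γ A) ≅ ⟨Y⟩ where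
  hom := cls f hf
  inv := cls g hg
  hom_inv_id := (cls_comp _ _ _ _).trans ((cls_congr _ h₁).trans (cls_id X))
  inv_hom_id := (cls_comp _ _ _ _).trans ((cls_congr _ h₂).trans (cls_id Y))

lemma shiftZeroIso_mem (X : A) : (sh Γ X 0).s ∈ cocycles Γ X (sh Γ X 0).obj :=
  ⟨by simpa using (sh Γ X 0).s_mem, (sh Γ X 0).d_s⟩

lemma shiftAddIso_mem (X : A) (n m : ℤ) :
    (sh Γ X (n + m)).t ≫ (sh Γ X n).s ≫ (sh Γ (sh Γ X n).obj m).s ∈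
      cocycles Γ (sh Γ X (n + m)).obj (sh Γ (sh Γ X n).obj m).obj :=
  mem_cocycles_of (sh Γ X (n + m)).t_mem
    (comp_mem (sh Γ X n).s_mem (sh Γ (sh Γ X n).obj m).s_mem)
    (by rw [add_smul]; abel) (ShiftData.d_t _)
    (d_comp_zero (ShiftData.s_mem _) (ShiftData.d_s _) (ShiftData.d_s _))

/-- `X[0] ≅ X`. -/
noncomputable def shiftZeroIso (X : A) : (⟨(sh Γ X 0).obj⟩ : H0 Γ A) ≅ ⟨X⟩ :=
  H0.isoOf (sh Γ X 0).t (sh Γ X 0).s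
    ⟨by simpa using (sh Γ X 0).t_mem, (sh Γ X 0).d_t⟩
    (shiftZeroIso_mem X) (by simp) (by simp)

/-- `X[n + m] ≅ X[n][m]`. -/
noncomputable def shiftAddIso (X : A) (n m : ℤ) :
    (⟨(sh Γ X (n + m)).obj⟩ : H0 Γ A) ≅ ⟨(sh Γ (sh Γ X n).obj m).obj⟩ :=
  H0.isoOf ((sh Γ X (n + m)).t ≫ (sh Γ X n).s ≫ (sh Γ (sh Γ X n).obj m).s)
    (((sh Γ (sh Γ X n).obj m).t ≫ (sh Γ X n).t) ≫ (sh Γ X (n + m)).s)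
    (shiftAddIso_mem X n m)
    (mem_cocycles_of (comp_mem (sh Γ (sh Γ X n).obj m).t_mem (sh Γ X n).t_mem)
      (sh Γ X (n + m)).s_mem
      (by rw [add_smul]; abel)
      (d_comp_zero (ShiftData.t_mem _) (ShiftData.d_t _) (ShiftData.d_t _)) (ShiftData.d_s _))
    (by simp) (by simp)

lemma shiftAddIso_naturality {X Y : A} (n m : ℤ) (f : X ⟶ Y) :
    ((sh Γ X (n + m)).t ≫ f ≫ (sh Γ Y (n + m)).s) ≫
      (sh Γ Y (n + m)).t ≫ (sh Γ Y n).s ≫ (sh Γ (sh Γ Y n).obj m).s =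
    ((sh Γ X (n + m)).t ≫ (sh Γ X n).s ≫ (sh Γ (sh Γ X n).obj m).s) ≫
      (sh Γ (sh Γ X n).obj m).t ≫ ((sh Γ X n).t ≫ f ≫ (sh Γ Y n).s) ≫
        (sh Γ (sh Γ Y n).obj m).s := by simp

lemma shiftAddIso_assoc (X : A) (m₁ m₂ m₃ : ℤ) :
    ((sh Γ X (m₁ + m₂ + m₃)).t ≫ (sh Γ X (m₁ + m₂)).s ≫ (sh Γ (sh Γ X (m₁ + m₂)).obj m₃).s) ≫
      (sh Γ (sh Γ X (m₁ + m₂)).obj m₃).t ≫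
        ((sh Γ X (m₁ + m₂)).t ≫ (sh Γ X m₁).s ≫ (sh Γ (sh Γ X m₁).obj m₂).s) ≫
          (sh Γ (sh Γ (sh Γ X m₁).obj m₂).obj m₃).s =
    (sh Γ X (m₁ + m₂ + m₃)).t ≫ (sh Γ X m₁).s ≫ (sh Γ (sh Γ X m₁).obj m₂).s ≫
      (sh Γ (sh Γ (sh Γ X m₁).obj m₂).obj m₃).s := by simp

lemma shiftAddIso_assoc' (X : A) (m₁ m₂ m₃ : ℤ) :
    ((sh Γ X (m₁ + (m₂ + m₃))).t ≫ (sh Γ X m₁).s ≫ (sh Γ (sh Γ X m₁).obj (m₂ + m₃)).s) ≫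
      (sh Γ (sh Γ X m₁).obj (m₂ + m₃)).t ≫ (sh Γ (sh Γ X m₁).obj m₂).s ≫
        (sh Γ (sh Γ (sh Γ X m₁).obj m₂).obj m₃).s =
    (sh Γ X (m₁ + (m₂ + m₃))).t ≫ (sh Γ X m₁).s ≫ (sh Γ (sh Γ X m₁).obj m₂).s ≫
      (sh Γ (sh Γ (sh Γ X m₁).obj m₂).obj m₃).s := by simp

lemma shift_eqToHom {X Z : A} {n m : ℤ} (h : n = m)
    (hF : (⟨(sh Γ X n).obj⟩ : H0 Γ A) = ⟨(sh Γ X m).obj⟩)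
    {f : X ⟶ Z} {g : (sh Γ X m).obj ⟶ Z} (hg : g ∈ cocycles Γ (sh Γ X m).obj Z)
    (hgf : g = (sh Γ X m).t ≫ f) {k : (sh Γ X n).obj ⟶ Z} (hk : k ∈ cocycles Γ (sh Γ X n).obj Z)
    (hkf : k = (sh Γ X n).t ≫ f) :
    H0.cls k hk = eqToHom hF ≫ H0.cls g hg := by
  subst h hgf hkf
  simp

/-- The coherence data of the shift on `H⁰(A)`. -/
noncomputable def shiftCore : ShiftMkCore (H0 Γ A) ℤ where
  F := shiftF
  zero := NatIso.ofComponents (fun X => shiftZeroIso X.obj) (by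
    rintro ⟨X⟩ ⟨Y⟩ f
    obtain ⟨f, hf, rfl⟩ := H0.cls_surjective f
    exact (shift_comp_eq (by simp)).trans (H0.cls_comp _ _ _ _).symm)
  add n m := NatIso.ofComponents (fun X => shiftAddIso X.obj n m) (by
    rintro ⟨X⟩ ⟨Y⟩ f
    obtain ⟨f, hf, rfl⟩ := H0.cls_surjective f
    exact (shift_comp_eq (shiftAddIso_naturality n m f)).trans (H0.cls_comp _ _ _ _).symm)
  assoc_hom_app m₁ m₂ m₃ := by
    rintro ⟨X⟩
    have h : ∀ hg, _ = eqToHom _ ≫ H0.cls ((sh Γ X (m₁ + (m₂ + m₃))).t ≫ (sh Γ X m₁).s ≫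
      (sh Γ (sh Γ X m₁).obj m₂).s ≫ (sh Γ (sh Γ (sh Γ X m₁).obj m₂).obj m₃).s) hg :=
      fun hg => shift_eqToHom (add_assoc m₁ m₂ m₃) (by rw [add_assoc]) hg rfl
      (comp_mem_cocycles (shiftAddIso_mem X (m₁ + m₂) m₃)
        (shift_mem _ _ (shiftAddIso_mem X m₁ m₂))) (shiftAddIso_assoc X m₁ m₂ m₃)
    have e := comp_mem_cocycles (shiftAddIso_mem X m₁ (m₂ + m₃))
      (shiftAddIso_mem (sh Γ X m₁).obj m₂ m₃)
    rw [shiftAddIso_assoc'] at e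
    exact (h e).trans (congrArg (eqToHom _ ≫ ·)
      (shift_comp_eq (shiftAddIso_assoc' X m₁ m₂ m₃)).symm)
  zero_add_hom_app n := by
    rintro ⟨X⟩
    refine shift_eqToHom (zero_add n) _ (f := (sh Γ X 0).s ≫ (sh Γ (sh Γ X 0).obj n).s)
      (shift_mem _ _ (shiftZeroIso_mem X)) rfl (shiftAddIso_mem X 0 n) (by simp)
  add_zero_hom_app n := by
    rintro ⟨X⟩
    refine shift_eqToHom (add_zero n) _ (f := (sh Γ X n).s ≫ (sh Γ (sh Γ X n).obj 0).s)
      (shiftZeroIso_mem (sh Γ X n).obj) (by simp) (shiftAddIso_mem X n 0) (by simp)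

noncomputable instance : HasShift (H0 Γ A) ℤ := hasShiftMk _ _ shiftCore

instance (n : ℤ) : (shiftFunctor (H0 Γ A) n).Additive where
  map_add {X Y} f g := (shiftMap (sh Γ X.obj n) (sh Γ Y.obj n)).map_add f g

lemma shiftFunctor_map_cls {X Y : A} (n : ℤ) (f : X ⟶ Y) (hf : f ∈ cocycles Γ X Y) :
    (shiftFunctor (H0 Γ A) n).map (H0.cls f hf) =
      H0.cls _ (shift_mem (sh Γ X n) (sh Γ Y n) hf) := rfl

end Shift


section Generic

variable {C : Type u} [Category.{v} C] [HasShift C ℤ]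

/-- Completion of morphisms of triangles is invariant under isomorphisms of triangles. -/
lemma complete_of_iso {T₁ T₂ S₁ S₂ : Triangle C} (e : T₁ ≅ S₁) (e' : T₂ ≅ S₂)
    (H : ∀ (a : S₁.obj₁ ⟶ S₂.obj₁) (b : S₁.obj₂ ⟶ S₂.obj₂), S₁.mor₁ ≫ b = a ≫ S₂.mor₁ →
      ∃ c : S₁.obj₃ ⟶ S₂.obj₃, S₁.mor₂ ≫ c = b ≫ S₂.mor₂ ∧
        S₁.mor₃ ≫ (shiftFunctor C (1 : ℤ)).map a = c ≫ S₂.mor₃)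
    (a : T₁.obj₁ ⟶ T₂.obj₁) (b : T₁.obj₂ ⟶ T₂.obj₂) (comm : T₁.mor₁ ≫ b = a ≫ T₂.mor₁) :
    ∃ c : T₁.obj₃ ⟶ T₂.obj₃, T₁.mor₂ ≫ c = b ≫ T₂.mor₂ ∧
        T₁.mor₃ ≫ (shiftFunctor C (1 : ℤ)).map a = c ≫ T₂.mor₃ := by
  obtain ⟨c, hc₁, hc₂⟩ := H (e.inv.hom₁ ≫ a ≫ e'.hom.hom₁) (e.inv.hom₂ ≫ b ≫ e'.hom.hom₂) (by
    have h₁ := e.inv.comm₁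
    have h₂ := e'.hom.comm₁
    rw [reassoc_of% h₁, reassoc_of% comm, h₂, Category.assoc, Category.assoc])
  refine ⟨e.hom.hom₃ ≫ c ≫ e'.inv.hom₃, ?_, ?_⟩
  · have h₁ := e.hom.comm₂
    have h₂ := e'.inv.comm₂
    rw [reassoc_of% h₁, reassoc_of% hc₁, h₂]
    simp
  · have h₁ := e.hom.comm₃
    have h₂ := e'.inv.comm₃
    rw [Category.assoc, Category.assoc, ← h₂, ← reassoc_of% hc₂, ← reassoc_of% h₁,
      ← Functor.map_comp, ← Functor.map_comp]
    simp

end Generic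

section Triangulated

variable {Γ A}

namespace ConeData

variable {X Y : A} {f : X ⟶ Y} (C : ConeData Γ f)

lemma fst_shift :
    C.fst ≫ (sh Γ X 1).s ∈ cocycles Γ C.obj (sh Γ X 1).obj :=
  mem_cocycles_of C.fst_mem (sh Γ X 1).s_mem (by simp) C.d_fst (sh Γ X 1).d_s

/-- The triangle `X ⟶ Y ⟶ cone(f) ⟶ X[1]` in `H⁰(A)`. -/
noncomputable def triangle (hf : f ∈ cocycles Γ X Y) :
    Triangle (H0 Γ A) :=
  Triangle.mk (H0.cls f hf) (H0.cls C.inr C.inr_cocycle)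
    (Z := (⟨C.obj⟩ : H0 Γ A)) (H0.cls (C.fst ≫ (sh Γ X 1).s) C.fst_shift)

end ConeData

lemma complete_std {X Y X' Y' : A} {f : X ⟶ Y} {f' : X' ⟶ Y'} (hf : f ∈ cocycles Γ X Y)
    (hf' : f' ∈ cocycles Γ X' Y') (C : ConeData Γ f) (C' : ConeData Γ f')
    (a : (⟨X⟩ : H0 Γ A) ⟶ ⟨X'⟩) (b : (⟨Y⟩ : H0 Γ A) ⟶ ⟨Y'⟩)
    (comm : H0.cls f hf ≫ b = a ≫ H0.cls f' hf') :
    ∃ c : (⟨C.obj⟩ : H0 Γ A) ⟶ ⟨C'.obj⟩,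
      (C.triangle hf).mor₂ ≫ c = b ≫ (C'.triangle hf').mor₂ ∧
      (C.triangle hf).mor₃ ≫ (shiftFunctor (H0 Γ A) 1).map a = c ≫ (C'.triangle hf').mor₃ := by
  obtain ⟨a, ha, rfl⟩ := H0.cls_surjective a
  obtain ⟨b, hb, rfl⟩ := H0.cls_surjective b
  obtain ⟨h, hh, e⟩ := H0.cls_eq_iff.1 comm.symm
  change d Γ h = f ≫ b - a ≫ f' at e
  have ha2 : d Γ a = 0 := ha.2
  have hb2 : d Γ b = 0 := hb.2
  have m₁ := comp_mem' C.fst_mem (comp_mem ha.1 C'.inl_mem) (by abel : _ = (0 : Γ))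
  have m₂ := comp_mem' C.snd_mem (comp_mem hb.1 C'.inr_mem) (by abel : _ = (0 : Γ))
  have m₃ := comp_mem' C.fst_mem (comp_mem hh C'.inr_mem) (by abel : _ = (0 : Γ))
  have hc : C.fst ≫ a ≫ C'.inl + C.snd ≫ b ≫ C'.inr + C.fst ≫ h ≫ C'.inr ∈
      cocycles Γ C.obj C'.obj := by
    refine ⟨add_mem (add_mem m₁ m₂) m₃, ?_⟩
    change d Γ _ = 0
    rw [map_add, map_add, leibniz C.fst _ (comp_mem ha.1 C'.inl_mem), leibniz a _ C'.inl_mem,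
      leibniz C.snd _ (comp_mem hb.1 C'.inr_mem), leibniz b _ C'.inr_mem,
      leibniz C.fst _ (comp_mem hh C'.inr_mem), leibniz h _ C'.inr_mem, e]
    simp [ha2, hb2, C'.d_inl, sgn_zero]
    abel
  refine ⟨H0.cls _ hc, ?_, ?_⟩
  · exact (shift_comp_eq (by simp)).trans (H0.cls_comp _ _ _ _).symm
  · have e₂ : (C.fst ≫ (sh Γ X 1).s) ≫ (sh Γ X 1).t ≫ a ≫ (sh Γ X' 1).s =
      (C.fst ≫ a ≫ C'.inl + C.snd ≫ b ≫ C'.inr + C.fst ≫ h ≫ C'.inr) ≫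
        C'.fst ≫ (sh Γ X' 1).s := by simp
    exact (shift_comp_eq e₂).trans (H0.cls_comp _ _ _ _).symm

lemma sgn_neg_one' : sgn (-one : Γ) = -1 := by rw [sgn_neg, sgn_one]

/-- The rotation of the triangle of a cone. -/
noncomputable def rotateStd {X Y : A} {f : X ⟶ Y} (hf : f ∈ cocycles Γ X Y) (C : ConeData Γ f)
    (D : ConeData Γ C.inr) : (C.triangle hf).rotate ≅ D.triangle C.inr_cocycle := by
  have df : d Γ f = 0 := hf.2
  let S := sh Γ X 1
  have hS : S.s ∈ hom X S.obj (-one : Γ) := by simpa using S.s_mem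
  have hT : S.t ∈ hom S.obj X (one : Γ) := by simpa using S.t_mem
  have m₁ := comp_mem C.inl_mem D.inr_mem
  have m₂ := comp_mem hf.1 D.inl_mem
  have hψ : S.t ≫ C.inl ≫ D.inr - S.t ≫ f ≫ D.inl ∈ cocycles Γ S.obj D.obj := by
    refine ⟨(hom S.obj D.obj (0 : Γ)).sub_mem (comp_mem' hT m₁ (by abel)) (comp_mem' hT m₂ (by abel)), ?_⟩
    change d Γ _ = 0
    rw [map_sub, leibniz _ _ m₁, leibniz _ _ D.inr_mem, leibniz _ _ m₂, leibniz _ _ D.inl_mem]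
    simp [S.d_t, df, C.d_inl, D.d_inl, sgn_zero]
  have hφ : D.snd ≫ C.fst ≫ S.s ∈ cocycles Γ D.obj S.obj := by
    have m := comp_mem' C.fst_mem hS (add_neg_cancel _)
    refine ⟨comp_mem' D.snd_mem m (by abel), ?_⟩
    change d Γ _ = 0
    rw [leibniz _ _ m, leibniz _ _ hS]
    simp [S.d_s]
  have m₃ := comp_mem C.snd_mem D.inl_mem
  let e : (⟨S.obj⟩ : H0 Γ A) ≅ ⟨D.obj⟩ := H0.homotopyIso _ _ hψ hφ (by simp)
    (D.snd ≫ C.snd ≫ D.inl) (comp_mem' D.snd_mem m₃ (by abel)) (by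
      rw [leibniz _ _ m₃, leibniz _ _ D.inl_mem, ← D.total]
      have h := C.total
      have h₂ : D.snd ≫ D.inr = D.snd ≫ (C.fst ≫ C.inl + C.snd ≫ C.inr) ≫ D.inr := by
        rw [h, Category.id_comp]
      rw [h₂]
      simp [D.d_inl, sgn_neg_one']
      abel)
  refine Triangle.isoMk _ _ (Iso.refl _) (Iso.refl _) e ?_ ?_ ?_
  · exact (Category.comp_id _).trans (Category.id_comp _).symm
  · refine Eq.trans ?_ (Category.id_comp _).symm
    refine (Iso.eq_comp_inv e).1 ?_
    exact (shift_comp_eq (by simp [S])).symm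
  · refine Eq.trans ?_ (shift_comp_eq (k := -(S.t ≫ f ≫ (sh Γ Y 1).s))
      (hk := neg_mem (shift_mem _ _ hf)) (by simp)).symm
    refine (congrArg (_ ≫ ·) ((shiftFunctor (H0 Γ A) 1).map_id _)).trans (Category.comp_id _)

/-- A triangle whose rotation is isomorphic to the triangle of a given cone. -/
lemma invRotateStd {Y Z : A} {g : Y ⟶ Z} (hg : g ∈ cocycles Γ Y Z) (C : ConeData Γ g) :
    ∃ (W : A) (f : W ⟶ Y) (hf : f ∈ cocycles Γ W Y) (K : ConeData Γ f),
      Nonempty ((K.triangle hf).rotate ≅ C.triangle hg) := by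
  have dg : d Γ g = 0 := hg.2
  obtain ⟨D⟩ := HasShiftsAndCones.shift C.obj (-one : Γ)
  have hu : D.t ∈ hom D.obj C.obj (-one : Γ) := D.t_mem
  have hv : D.s ∈ hom C.obj D.obj (one : Γ) := by simpa using D.s_mem
  have hf : -(D.t ≫ C.fst) ∈ cocycles Γ D.obj Y :=
    neg_mem (mem_cocycles_of hu C.fst_mem (by simp) D.d_t C.d_fst)
  obtain ⟨K⟩ := HasShiftsAndCones.cone _ hf
  refine ⟨_, _, hf, K, ⟨?_⟩⟩
  have m₁ := comp_mem' hv K.inl_mem (add_neg_cancel _)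
  have hφ : C.inr ≫ D.s ≫ K.inl ∈ cocycles Γ Z K.obj := by
    refine ⟨comp_mem' C.inr_mem m₁ (by abel), ?_⟩
    change d Γ _ = 0
    rw [leibniz _ _ m₁, leibniz _ _ K.inl_mem]
    simp [D.d_s, K.d_inl]
  have m₂ := comp_mem' hu C.snd_mem (add_zero _)
  have hψ : K.snd ≫ g + K.fst ≫ D.t ≫ C.snd ∈ cocycles Γ K.obj Z := by
    refine ⟨add_mem (comp_mem' K.snd_mem hg.1 (by abel)) (comp_mem' K.fst_mem m₂ (by abel)), ?_⟩
    change d Γ _ = 0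
    rw [map_add, leibniz _ _ hg.1, leibniz _ _ m₂, leibniz _ _ C.snd_mem]
    simp [D.d_t, dg, sgn_zero]
  have m₃ := comp_mem C.inl_mem m₁
  let e : (⟨Z⟩ : H0 Γ A) ≅ ⟨K.obj⟩ := H0.homotopyIso _ _ hφ hψ (by simp)
    (-(K.snd ≫ C.inl ≫ D.s ≫ K.inl)) (neg_mem (comp_mem' K.snd_mem m₃ (by abel))) (by
      rw [map_neg, leibniz _ _ m₃, leibniz _ _ m₁, leibniz _ _ K.inl_mem, ← K.total]
      have h₂ : K.fst ≫ K.inl = K.fst ≫ D.t ≫ (C.fst ≫ C.inl + C.snd ≫ C.inr) ≫ D.s ≫ K.inl := by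
        rw [C.total]; simp
      rw [h₂]
      simp [D.d_s, K.d_inl, C.d_inl, sgn_zero, sgn_neg_one']
      abel)
  let S := sh Γ D.obj 1
  have hS : S.s ∈ hom D.obj S.obj (-one : Γ) := by simpa using S.s_mem
  have hT : S.t ∈ hom S.obj D.obj (one : Γ) := by simpa using S.t_mem
  let e' : (⟨S.obj⟩ : H0 Γ A) ≅ ⟨C.obj⟩ := H0.isoOf (S.t ≫ D.t) (D.s ≫ S.s)
    (mem_cocycles_of hT hu (add_neg_cancel _) S.d_t D.d_t)
    (mem_cocycles_of hv hS (add_neg_cancel _) D.d_s S.d_s) (by simp) (by simp)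
  refine Triangle.isoMk _ _ (Iso.refl _) e.symm e' ?_ ?_ ?_
  · refine Eq.trans ?_ (Category.id_comp _).symm
    exact (shift_comp_eq (by simp))
  · refine (Iso.eq_inv_comp e).2 ?_
    refine (congrArg (e.hom ≫ ·) (H0.cls_comp _ _ _ _)).trans ?_
    have e₂ : (C.inr ≫ D.s ≫ K.inl) ≫ (K.fst ≫ S.s) ≫ S.t ≫ D.t = C.inr := by simp
    exact shift_comp_eq e₂
  · refine (congrArg (_ ≫ ·) ((shiftFunctor (H0 Γ A) 1).map_id _)).trans
      ((Category.comp_id _).trans ?_)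
    have e₂ : (S.t ≫ D.t) ≫ C.fst ≫ (sh Γ Y 1).s = -(S.t ≫ (-(D.t ≫ C.fst)) ≫ (sh Γ Y 1).s) := by
      simp
    exact (shift_comp_eq (hk := neg_mem (shift_mem _ _ hf)) e₂).symm

instance : Pretriangulated (H0 Γ A) where
  distinguishedTriangles := {T | ∃ (X Y : A) (f : X ⟶ Y) (hf : f ∈ cocycles Γ X Y)
    (C : ConeData Γ f), Nonempty (T ≅ C.triangle hf)}
  isomorphic_distinguished := by
    rintro T ⟨X, Y, f, hf, C, ⟨e⟩⟩ T' e'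
    exact ⟨X, Y, f, hf, C, ⟨e' ≪≫ e⟩⟩
  contractible_distinguished := by
    rintro ⟨X⟩
    obtain ⟨C⟩ := HasShiftsAndCones.cone _ (id_mem_cocycles (Γ := Γ) X)
    have hC : IsZero (⟨C.obj⟩ : H0 Γ A) := by
      rw [IsZero.iff_id_eq_zero]
      have m := comp_mem' C.snd_mem C.inl_mem (zero_add _)
      refine (H0.cls_eq_iff.2 ⟨C.snd ≫ C.inl, m, ?_⟩ : H0.cls 0 (zero_mem _) = _).symm
      rw [leibniz _ _ C.inl_mem, ← C.total]
      simp [C.d_inl, sgn_neg_one', add_comm]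
    refine ⟨_, _, _, id_mem_cocycles X, C, ⟨Triangle.isoMk _ _ (Iso.refl _) (Iso.refl _)
      ((isZero_zero _).iso hC) ?_ (hC.eq_of_tgt _ _) ((isZero_zero _).eq_of_src _ _)⟩⟩
    rfl
  distinguished_cocone_triangle := by
    rintro ⟨X⟩ ⟨Y⟩ f
    obtain ⟨f, hf, rfl⟩ := H0.cls_surjective f
    obtain ⟨C⟩ := HasShiftsAndCones.cone f hf
    exact ⟨_, _, _, X, Y, f, hf, C, ⟨Iso.refl _⟩⟩
  rotate_distinguished_triangle T := by
    constructor
    · rintro ⟨X, Y, f, hf, C, ⟨e⟩⟩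
      obtain ⟨D⟩ := HasShiftsAndCones.cone _ C.inr_cocycle
      exact ⟨_, _, _, _, D, ⟨(rotate (H0 Γ A)).mapIso e ≪≫ rotateStd hf C D⟩⟩
    · rintro ⟨X, Y, g, hg, C, ⟨e⟩⟩
      obtain ⟨W, f, hf, K, ⟨e'⟩⟩ := invRotateStd hg C
      exact ⟨W, X, f, hf, K,
        ⟨(triangleRotation (H0 Γ A)).functor.preimageIso (e ≪≫ e'.symm)⟩⟩
  complete_distinguished_triangle_morphism := by
    rintro T₁ T₂ ⟨X, Y, f, hf, C, ⟨e⟩⟩ ⟨X', Y', f', hf', C', ⟨e'⟩⟩ a b comm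
    exact complete_of_iso e e' (fun a b h => complete_std hf hf' C C' a b h) a b comm

/-- The third object of the octahedron is the cone of the map between the first two cones. -/
noncomputable def octIso {X Y Z : A} {f : X ⟶ Y} {g : Y ⟶ Z}
    (hg : g ∈ cocycles Γ Y Z) (C : ConeData Γ f) (C' : ConeData Γ g) (C'' : ConeData Γ (f ≫ g))
    (K : ConeData Γ (C.fst ≫ C''.inl + C.snd ≫ g ≫ C''.inr))
    (hf : f ∈ cocycles Γ X Y) : (⟨C'.obj⟩ : H0 Γ A) ≅ ⟨K.obj⟩ := by
  have df : d Γ f = 0 := hf.2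
  have dg : d Γ g = 0 := hg.2
  have m₁ := comp_mem C.inr_mem K.inl_mem
  have m₂ := comp_mem C''.inr_mem K.inr_mem
  have m₃ := comp_mem C.snd_mem C'.inl_mem
  have m₄ := comp_mem hf.1 C'.inl_mem
  have m₅ := comp_mem C.inl_mem K.inl_mem
  have m₆ := comp_mem C''.fst_mem m₅
  refine H0.homotopyIso (C'.fst ≫ C.inr ≫ K.inl + C'.snd ≫ C''.inr ≫ K.inr)
    (K.fst ≫ C.snd ≫ C'.inl + K.snd ≫ (C''.fst ≫ f ≫ C'.inl + C''.snd ≫ C'.inr)) ⟨add_mem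
      (comp_mem' C'.fst_mem m₁ (by abel)) (comp_mem' C'.snd_mem m₂ (by abel)), ?_⟩
    ⟨add_mem (comp_mem' K.fst_mem m₃ (by abel)) (comp_mem' K.snd_mem (oct_β_mem hf C' C'').1
      (by abel)), ?_⟩ ?_ (K.snd ≫ C''.fst ≫ C.inl ≫ K.inl)
      (comp_mem' K.snd_mem m₆ (by abel)) ?_
  · change d Γ _ = 0
    rw [map_add, leibniz _ _ m₁, leibniz _ _ m₂, leibniz _ _ K.inl_mem, leibniz _ _ K.inr_mem]
    simp [K.d_inl, sgn_zero]
  · have h : d Γ _ = 0 := (oct_β_mem hf C' C'').2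
    change d Γ _ = 0
    rw [map_add, leibniz _ _ m₃, leibniz _ _ (oct_β_mem hf C' C'').1, leibniz _ _ C'.inl_mem, h]
    simp [C'.d_inl, sgn_zero, sgn_neg_one']
  · rw [← C'.total]
    simp
  · rw [leibniz _ _ m₆, leibniz _ _ m₅, leibniz _ _ K.inl_mem, ← K.total]
    have h₁ : K.fst ≫ K.inl = K.fst ≫ (C.fst ≫ C.inl + C.snd ≫ C.inr) ≫ K.inl := by
      rw [C.total]; simp
    have h₂ : K.snd ≫ K.inr = K.snd ≫ (C''.fst ≫ C''.inl + C''.snd ≫ C''.inr) ≫ K.inr := by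
      rw [C''.total]; simp
    rw [h₁, h₂]
    simp [K.d_inl, C.d_inl, sgn_add, sgn_neg_one']
    abel

noncomputable instance : IsTriangulated (H0 Γ A) := IsTriangulated.mk' (by
  rintro ⟨X⟩ ⟨Y⟩ ⟨Z⟩ u v
  obtain ⟨f, hf, rfl⟩ := H0.cls_surjective u
  obtain ⟨g, hg, rfl⟩ := H0.cls_surjective v
  obtain ⟨C⟩ := HasShiftsAndCones.cone f hf
  obtain ⟨C'⟩ := HasShiftsAndCones.cone g hg
  obtain ⟨C''⟩ := HasShiftsAndCones.cone (f ≫ g) (comp_mem_cocycles hf hg)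
  have hα := oct_α_mem hg C C''
  obtain ⟨K⟩ := HasShiftsAndCones.cone _ hα
  refine ⟨_, _, _, _, _, _, H0.cls f hf, H0.cls g hg, Iso.refl _, Iso.refl _, Iso.refl _,
    (Category.comp_id _).trans (Category.id_comp _).symm,
    (Category.comp_id _).trans (Category.id_comp _).symm,
    _, _, ⟨_, _, f, hf, C, ⟨Iso.refl _⟩⟩, _, _, ⟨_, _, g, hg, C', ⟨Iso.refl _⟩⟩,
    _, _, ⟨_, _, f ≫ g, comp_mem_cocycles hf hg, C'', ⟨Iso.refl _⟩⟩, ⟨?_⟩⟩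
  have hβ := oct_β_mem hf C' C''
  let e := octIso hg C C' C'' K hf
  refine Triangulated.Octahedron.mk (H0.cls _ hα) (H0.cls _ hβ) ?_ ?_ ?_ ?_ ?_
  · exact (shift_comp_eq (by simp)).trans (H0.cls_comp _ _ _ _).symm
  · exact (shift_comp_eq (by simp))
  · exact (shift_comp_eq (by simp))
  · have h : (C''.fst ≫ (sh Γ X 1).s) ≫ (sh Γ X 1).t ≫ f ≫ (sh Γ Y 1).s =
      (C''.fst ≫ f ≫ C'.inl + C''.snd ≫ C'.inr) ≫ C'.fst ≫ (sh Γ Y 1).s := by simp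
    exact (shift_comp_eq h).trans (H0.cls_comp _ _ _ _).symm
  · refine ⟨_, _, _, hα, K, ⟨Triangle.isoMk _ _ (Iso.refl _) (Iso.refl _) e ?_ ?_ ?_⟩⟩
    · exact (Category.comp_id _).trans (Category.id_comp _).symm
    · refine Eq.trans ?_ (Category.id_comp _).symm
      refine (Iso.eq_comp_inv e).1 ?_
      exact (shift_comp_eq (by simp)).symm
    · refine (congrArg (_ ≫ ·) ((shiftFunctor (H0 Γ A) 1).map_id _)).trans
        ((Category.comp_id _).trans ?_)
      have h : (C'.fst ≫ (sh Γ Y 1).s) ≫ (sh Γ Y 1).t ≫ C.inr ≫ (sh Γ C.obj 1).s =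
        (C'.fst ≫ C.inr ≫ K.inl + C'.snd ≫ C''.inr ≫ K.inr) ≫ K.fst ≫ (sh Γ C.obj 1).s := by simp
      exact (shift_comp_eq h).trans (H0.cls_comp _ _ _ _).symm)

end Triangulated

end Categories

end DG

namespace DG

open DGCategory

variable {Γ : Type t} [AddCommGroup Γ] [GradingDatum Γ]

section Grading

lemma coe_injective_of_internal {I : Type t} [DecidableEq I] {G : Type v} [AddCommGroup G]
    {H : I → AddSubgroup G} (h : DirectSum.IsInternal H) {e : I → I} (he : Function.Injective e) :
    Function.Injective (DirectSum.coeAddMonoidHom (fun i => H (e i))) :=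
  (h.addSubgroup_iSupIndep.comp he).dfinsuppSumAddHom_injective

variable {A : Type u} [Category.{v} A] [Preadditive A] [DGCategory Γ A]

/-- The homogeneous components of a closed morphism are closed. -/
lemma d_component [DecidableEq Γ] {X Y : A}
    (x : DirectSum Γ (fun i => (hom X Y i : AddSubgroup (X ⟶ Y))))
    (hx : d Γ (DirectSum.coeAddMonoidHom (hom X Y) x) = 0) (i : Γ) : d Γ (x i : X ⟶ Y) = 0 := by
  have hI : DirectSum.IsInternal (hom (Γ := Γ) X Y) := by
    convert isInternal (Γ := Γ) X Y
  have hinj := coe_injective_of_internal hI (add_left_injective (one : Γ))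
  let F : ∀ i : Γ, (hom X Y i : AddSubgroup (X ⟶ Y)) →+
      (hom X Y (i + one) : AddSubgroup (X ⟶ Y)) :=
    fun i => ((d Γ).comp (hom X Y i).subtype).codRestrict _ (fun a => d_mem a.2)
  have key : ∀ x, DirectSum.coeAddMonoidHom (fun i : Γ => hom X Y (i + one))
      (DirectSum.map F x) = d Γ (DirectSum.coeAddMonoidHom (hom X Y) x) := by
    intro x
    induction x using DirectSum.induction_on with
    | zero => simp
    | of i x => simp [F]
    | add x y hx hy => simp only [map_add, hx, hy]
  have h0 : DirectSum.map F x = 0 := hinj (by rw [key, hx, map_zero])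
  have h1 : DirectSum.map F x i = 0 := by rw [h0]; rfl
  rw [DirectSum.map_apply] at h1
  exact congrArg Subtype.val h1

variable (Γ) in
/-- The sign involution `f ↦ (-1)^{|f|} f` on the total group of morphisms. -/
noncomputable def sign (X Y : A) : (X ⟶ Y) →+ (X ⟶ Y) :=
  letI := Classical.decEq Γ
  (DirectSum.toAddMonoid (fun i : Γ => sgn i • (hom X Y i).subtype)).comp
    (AddEquiv.ofBijective _ (isInternal (Γ := Γ) X Y)).symm.toAddMonoidHom

lemma sign_of_mem {X Y : A} {i : Γ} {f : X ⟶ Y} (hf : f ∈ hom X Y i) :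
    sign Γ X Y f = sgn i • f := by
  let := Classical.decEq Γ
  have h : (AddEquiv.ofBijective _ (isInternal (Γ := Γ) X Y)).symm f =
      DirectSum.of (fun i => (hom X Y i : AddSubgroup (X ⟶ Y))) i ⟨f, hf⟩ := by
    rw [AddEquiv.symm_apply_eq]
    exact (DirectSum.coeAddMonoidHom_of (hom X Y) i ⟨f, hf⟩).symm
  change DirectSum.toAddMonoid _ ((AddEquiv.ofBijective _ (isInternal (Γ := Γ) X Y)).symm f) = _
  rw [h, DirectSum.toAddMonoid_of]
  rfl

lemma sign_mem {X Y : A} {i : Γ} {f : X ⟶ Y} (hf : f ∈ hom X Y i) :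
    sign Γ X Y f ∈ hom X Y i := by
  rw [sign_of_mem hf]
  exact zsmul_mem hf _

lemma sign_sign {X Y : A} (f : X ⟶ Y) : sign Γ X Y (sign Γ X Y f) = f := by
  refine hom_induction (Γ := Γ) (p := fun f => sign Γ X Y (sign Γ X Y f) = f) f (by simp)
    (fun f g hf hg => ?_) (fun i f hf => ?_)
  · rw [map_add, map_add, hf, hg]
  · rw [sign_of_mem hf, map_zsmul, sign_of_mem hf, smul_smul, sgn_mul_self, one_smul]

lemma sign_comp {X Y Z : A} (f : X ⟶ Y) (g : Y ⟶ Z) :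
    sign Γ X Z (f ≫ g) = sign Γ X Y f ≫ sign Γ Y Z g := by
  refine hom_induction (Γ := Γ)
    (p := fun f => sign Γ X Z (f ≫ g) = sign Γ X Y f ≫ sign Γ Y Z g) f (by simp)
    (fun f f' hf hf' => ?_) (fun i f hf => ?_)
  · rw [Preadditive.add_comp, map_add, hf, hf', map_add, Preadditive.add_comp]
  · refine hom_induction (Γ := Γ)
      (p := fun g => sign Γ X Z (f ≫ g) = sign Γ X Y f ≫ sign Γ Y Z g) g (by simp)
      (fun g g' hg hg' => ?_) (fun j g hg => ?_)
    · rw [Preadditive.comp_add, map_add, hg, hg', map_add, Preadditive.comp_add]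
    · rw [sign_of_mem hf, sign_of_mem hg, sign_of_mem (comp_mem hf hg), sgn_add]
      simp [smul_smul, mul_comm]

lemma d_sign {X Y : A} (f : X ⟶ Y) : d Γ (sign Γ X Y f) = -sign Γ X Y (d Γ f) := by
  refine hom_induction (Γ := Γ)
    (p := fun f => d Γ (sign Γ X Y f) = -sign Γ X Y (d Γ f)) f (by simp)
    (fun f f' hf hf' => ?_) (fun i f hf => ?_)
  · rw [map_add, map_add, map_add, map_add, hf, hf', neg_add]
  · rw [sign_of_mem hf, sign_of_mem (d_mem hf), sgn_add, sgn_one]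
    simp

/-- The Leibniz rule for not necessarily homogeneous morphisms. -/
lemma leibniz_sign {X Y Z : A} (f : X ⟶ Y) (g : Y ⟶ Z) :
    d Γ (f ≫ g) = f ≫ d Γ g + d Γ f ≫ sign Γ Y Z g := by
  refine hom_induction (Γ := Γ)
    (p := fun g => d Γ (f ≫ g) = f ≫ d Γ g + d Γ f ≫ sign Γ Y Z g) g (by simp)
    (fun g g' hg hg' => ?_) (fun j g hg => ?_)
  · rw [Preadditive.comp_add, map_add, hg, hg', map_add, map_add, Preadditive.comp_add,
      Preadditive.comp_add]
    abel
  · rw [leibniz f g hg, sign_of_mem hg]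
    simp

end Grading

section Bec

variable (A : Type u) [Category.{v} A] [Preadditive A] [DGCategory Γ A]

/-- The objects of the DG-category `A^♭`: the objects of `A` with a chosen contracting homotopy
with zero square. -/
structure Bec (Γ : Type t) [AddCommGroup Γ] [GradingDatum Γ] (A : Type u) [Category.{v} A]
    [Preadditive A] [DGCategory Γ A] where
  obj : A
  σ : obj ⟶ obj
  σ_mem : σ ∈ hom obj obj (-one : Γ)
  d_σ : d Γ σ = 𝟙 obj
  σ_σ : σ ≫ σ = 0

variable {A}

/-- The group of all closed morphisms (of all degrees). -/
abbrev closed (Γ : Type t) [AddCommGroup Γ] [GradingDatum Γ] [DGCategory Γ A]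
    (X Y : A) : AddSubgroup (X ⟶ Y) := (d Γ (X := X) (Y := Y)).ker

lemma id_mem_closed (X : A) : 𝟙 X ∈ closed Γ X X := d_id Γ X

lemma comp_mem_closed {X Y Z : A} {f : X ⟶ Y} {g : Y ⟶ Z} (hf : f ∈ closed Γ X Y)
    (hg : g ∈ closed Γ Y Z) : f ≫ g ∈ closed Γ X Z := by
  have h1 : d Γ f = 0 := hf
  have h2 : d Γ g = 0 := hg
  change d Γ _ = 0
  simp [leibniz_sign, h1, h2]

instance : Category.{v} (Bec Γ A) where
  Hom X Y := closed Γ X.obj Y.obj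
  id X := ⟨𝟙 X.obj, id_mem_closed X.obj⟩
  comp f g := ⟨f.1 ≫ g.1, comp_mem_closed f.2 g.2⟩

instance : Preadditive (Bec Γ A) where
  homGroup X Y := inferInstanceAs (AddCommGroup (closed Γ X.obj Y.obj))
  add_comp _ _ _ f g h := Subtype.ext (Preadditive.add_comp _ _ _ f.1 g.1 h.1)
  comp_add _ _ _ f g h := Subtype.ext (Preadditive.comp_add _ _ _ f.1 g.1 h.1)

/-- The component of degree `i` of the group of morphisms in `A^♭`: the closed morphisms
of degree `-i` in `A`. -/
def becHom (X Y : Bec Γ A) (i : Γ) : AddSubgroup (closed Γ X.obj Y.obj) :=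
  (hom X.obj Y.obj (-i)).addSubgroupOf (closed Γ X.obj Y.obj)

lemma becHom_isInternal [DecidableEq Γ] (X Y : Bec Γ A) :
    DirectSum.IsInternal (becHom X Y) := by
  have hI : DirectSum.IsInternal (hom (Γ := Γ) X.obj Y.obj) := by
    convert isInternal (Γ := Γ) X.obj Y.obj
  constructor
  · have hinj := coe_injective_of_internal hI (neg_injective (G := Γ))
    let F : ∀ i : Γ, becHom X Y i →+ (hom X.obj Y.obj (-i) : AddSubgroup (X.obj ⟶ Y.obj)) :=
      fun i => ((closed Γ X.obj Y.obj).subtype.comp (becHom X Y i).subtype).codRestrict _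
        (fun a => a.2)
    have key : ∀ x, DirectSum.coeAddMonoidHom (fun i : Γ => hom X.obj Y.obj (-i))
        (DirectSum.map F x) = (DirectSum.coeAddMonoidHom (becHom X Y) x).1 := by
      intro x
      induction x using DirectSum.induction_on with
      | zero => simp
      | of i x => simp only [F, DirectSum.map_of, DirectSum.coeAddMonoidHom_of]; rfl
      | add x y hx hy => simp only [map_add, hx, hy, AddSubgroup.coe_add]
    refine (injective_iff_map_eq_zero _).2 fun x hx => ?_
    have h0 : DirectSum.map F x = 0 := hinj (by rw [key, hx, map_zero]; rfl)
    refine DFinsupp.ext fun i => ?_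
    have h1 : DirectSum.map F x i = 0 := by rw [h0]; rfl
    rw [DirectSum.map_apply] at h1
    have h2 : (x i).1.1 = 0 := congrArg Subtype.val h1
    exact Subtype.ext (Subtype.ext h2)
  · rintro ⟨f, hf⟩
    obtain ⟨x, rfl⟩ := hI.2 f
    classical
    have hc := d_component x hf
    refine ⟨∑ i ∈ DFinsupp.support x, DirectSum.of (fun i => becHom X Y i) (-i)
      ⟨⟨(x i).1, hc i⟩, ?_⟩, ?_⟩
    · change (x i).1 ∈ hom X.obj Y.obj (- -i)
      rw [neg_neg]
      exact (x i).2
    · refine Subtype.ext ?_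
      rw [map_sum]
      refine (AddSubgroup.val_finsetSum (H := closed Γ X.obj Y.obj) _ _).trans ?_
      refine Eq.trans ?_ (DirectSum.coeAddMonoidHom_eq_dfinsuppSum _ x).symm
      refine Finset.sum_congr rfl fun i _ => ?_
      exact congrArg Subtype.val (DirectSum.coeAddMonoidHom_of (becHom X Y) (-i) _)

/-- The differential in `A^♭`: the graded commutator with the contracting homotopies. -/
noncomputable def becD (X Y : Bec Γ A) : closed Γ X.obj Y.obj →+ closed Γ X.obj Y.obj :=
  AddMonoidHom.mk' (fun f => ⟨f.1 ≫ Y.σ - X.σ ≫ sign Γ _ _ f.1, by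
    have h : d Γ f.1 = 0 := f.2
    change d Γ _ = 0
    rw [map_sub, leibniz_sign, leibniz_sign, d_sign, sign_sign, h, X.d_σ, Y.d_σ]
    simp⟩) (fun f g => Subtype.ext (by simp; abel))

variable (A) in
/-- The DG-category `A^♭`. -/
noncomputable instance : DGCategory Γ (Bec Γ A) where
  hom X Y := becHom X Y
  isInternal X Y := by
    let := Classical.decEq Γ
    exact becHom_isInternal X Y
  id_mem X := by
    change 𝟙 X.obj ∈ hom X.obj X.obj (-0 : Γ)
    rw [neg_zero]
    exact id_mem _
  comp_mem {X Y Z i j f g} hf hg := by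
    change f.1 ≫ g.1 ∈ hom X.obj Z.obj (-(i + j))
    exact comp_mem' hf hg (by abel)
  d {X Y} := becD X Y
  d_mem {X Y i f} hf := by
    change f.1 ≫ Y.σ - X.σ ≫ sign Γ _ _ f.1 ∈ hom X.obj Y.obj (-(i + one))
    exact (hom X.obj Y.obj (-(i + one))).sub_mem (comp_mem' hf Y.σ_mem (by abel))
      (comp_mem' X.σ_mem (sign_mem hf) (by abel))
  d_d {X Y} f := by
    refine Subtype.ext ?_
    change (f.1 ≫ Y.σ - X.σ ≫ sign Γ _ _ f.1) ≫ Y.σ -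
      X.σ ≫ sign Γ _ _ (f.1 ≫ Y.σ - X.σ ≫ sign Γ _ _ f.1) = 0
    rw [map_sub, sign_comp, sign_comp, sign_sign, sign_of_mem X.σ_mem, sign_of_mem Y.σ_mem,
      sgn_neg, sgn_one]
    have h₁ := X.σ_σ
    have h₂ := Y.σ_σ
    simp [reassoc_of% h₁, h₂]
  leibniz {X Y Z j} f g hg := by
    refine Subtype.ext ?_
    have hg' : sign Γ _ _ g.1 = sgn j • g.1 := by
      have hg : g.1 ∈ hom Y.obj Z.obj (-j) := hg
      rw [sign_of_mem hg, sgn_neg]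
    change (f.1 ≫ g.1) ≫ Z.σ - X.σ ≫ sign Γ _ _ (f.1 ≫ g.1) =
      f.1 ≫ (g.1 ≫ Z.σ - Y.σ ≫ sign Γ _ _ g.1) +
        sgn j • ((f.1 ≫ Y.σ - X.σ ≫ sign Γ _ _ f.1) ≫ g.1)
    rw [sign_comp, hg']
    simp [smul_sub]

end Bec

end DG

namespace DG

open DGCategory

variable {Γ : Type t} [AddCommGroup Γ] [GradingDatum Γ]

section Functors

variable (Γ) (A : Type u) [Category.{v} A] [Preadditive A] [DGCategory Γ A]

/-- The functor `Ψ⁺ : Z⁰(A^♭) ⥤ Z⁰(A)` forgetting the contracting homotopy. -/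
def psi : Z0 Γ (Bec Γ A) ⥤ Z0 Γ A where
  obj X := ⟨X.obj.obj⟩
  map {X Y} f := ⟨f.1.1, by
    have h : f.1.1 ∈ hom X.obj.obj Y.obj.obj (-0 : Γ) := f.2.1
    rwa [neg_zero] at h, f.1.2⟩

instance : (psi Γ A).Additive where

variable {A}

/-- The datum exhibiting an object as `cone(id_{X[-1]})`. -/
structure DoubleData (X : A) where
  obj : A
  ι : X ⟶ obj
  ι' : X ⟶ obj
  π : obj ⟶ X
  π' : obj ⟶ X
  ι_mem : ι ∈ hom X obj (one : Γ)
  ι'_mem : ι' ∈ hom X obj (0 : Γ)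
  π_mem : π ∈ hom obj X (0 : Γ)
  π'_mem : π' ∈ hom obj X (-one : Γ)
  ι_π : ι ≫ π = 0
  ι'_π' : ι' ≫ π' = 0
  ι_π' : ι ≫ π' = 𝟙 X
  ι'_π : ι' ≫ π = 𝟙 X
  total : π' ≫ ι + π ≫ ι' = 𝟙 obj
  d_ι : d Γ ι = 0
  d_π : d Γ π = 0
  d_ι' : d Γ ι' = ι
  d_π' : d Γ π' = π

variable {Γ}

/-- The cone of the identity of `X[-1]`. -/
def DoubleData.ofCone {X : A} (D : ShiftData X (-one : Γ)) (C : ConeData Γ (𝟙 D.obj)) :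
    DoubleData Γ X where
  obj := C.obj
  ι := D.s ≫ C.inr
  ι' := D.s ≫ C.inl
  π := C.fst ≫ D.t
  π' := C.snd ≫ D.t
  ι_mem := comp_mem' D.s_mem C.inr_mem (by simp)
  ι'_mem := comp_mem' D.s_mem C.inl_mem (by simp)
  π_mem := comp_mem' C.fst_mem D.t_mem (by simp)
  π'_mem := comp_mem' C.snd_mem D.t_mem (by simp)
  ι_π := by simp
  ι'_π' := by simp
  ι_π' := by simp
  ι'_π := by simp
  total := by simp [add_comm _ (C.fst ≫ C.inl), C.total]
  d_ι := by simp [leibniz _ _ C.inr_mem, D.d_s]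
  d_π := by simp [leibniz _ _ D.t_mem, D.d_t]
  d_ι' := by simp [leibniz _ _ C.inl_mem, D.d_s, C.d_inl]
  d_π' := by simp [leibniz _ _ D.t_mem, D.d_t, sgn_neg, sgn_one]

namespace DoubleData

attribute [simp] ι_π ι'_π' ι_π' ι'_π d_ι d_π d_ι' d_π'

variable {X Y : A} (D : DoubleData Γ X) (E : DoubleData Γ Y)

@[simp] lemma ι_π_assoc {Z : A} (g : X ⟶ Z) : D.ι ≫ D.π ≫ g = 0 := by
  rw [← Category.assoc, D.ι_π, zero_comp]

@[simp] lemma ι'_π'_assoc {Z : A} (g : X ⟶ Z) : D.ι' ≫ D.π' ≫ g = 0 := by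
  rw [← Category.assoc, D.ι'_π', zero_comp]

@[simp] lemma ι_π'_assoc {Z : A} (g : X ⟶ Z) : D.ι ≫ D.π' ≫ g = g := by
  rw [← Category.assoc, D.ι_π', Category.id_comp]

@[simp] lemma ι'_π_assoc {Z : A} (g : X ⟶ Z) : D.ι' ≫ D.π ≫ g = g := by
  rw [← Category.assoc, D.ι'_π, Category.id_comp]

/-- `cone(id_{X[-1]})` as an object of `A^♭`. -/
def bec : Bec Γ A where
  obj := D.obj
  σ := D.π' ≫ D.ι'
  σ_mem := comp_mem' D.π'_mem D.ι'_mem (by abel)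
  d_σ := by simp [leibniz _ _ D.ι'_mem, sgn_zero, D.total]
  σ_σ := by simp

/-- The map of cones induced by `f`. -/
def map (f : X ⟶ Y) : D.obj ⟶ E.obj := D.π' ≫ f ≫ E.ι + D.π ≫ f ≫ E.ι'

lemma map_mem {f : X ⟶ Y} (hf : f ∈ cocycles Γ X Y) : D.map E f ∈ hom D.obj E.obj (0 : Γ) :=
  add_mem (comp_mem' D.π'_mem (comp_mem hf.1 E.ι_mem) (by abel))
    (comp_mem' D.π_mem (comp_mem hf.1 E.ι'_mem) (by abel))

lemma d_map {f : X ⟶ Y} (hf : f ∈ cocycles Γ X Y) : d Γ (D.map E f) = 0 := by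
  have h : d Γ f = 0 := hf.2
  simp [map, leibniz _ _ (comp_mem hf.1 E.ι_mem), leibniz _ _ E.ι_mem,
    leibniz _ _ (comp_mem hf.1 E.ι'_mem), leibniz _ _ E.ι'_mem, h, sgn_one]

/-- The map of cones as a closed morphism of degree `0` in `A^♭`. -/
def becMap (f : cocycles Γ X Y) :
    (⟨D.bec⟩ : Z0 Γ (Bec Γ A)) ⟶ ⟨E.bec⟩ :=
  ⟨⟨D.map E f.1, D.d_map E f.2⟩, by
    change D.map E f.1 ∈ hom D.obj E.obj (-0 : Γ)
    rw [neg_zero]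
    exact D.map_mem E f.2, by
    refine Subtype.ext ?_
    change D.map E f.1 ≫ E.π' ≫ E.ι' - (D.π' ≫ D.ι') ≫ sign Γ _ _ (D.map E f.1) = 0
    rw [sign_of_mem (D.map_mem E f.2), sgn_zero]
    simp [map]⟩

end DoubleData

variable (Γ A)

variable [HasShiftsAndCones Γ A]

variable {A} in
lemma exists_doubleData (X : A) : Nonempty (DoubleData Γ X) := by
  obtain ⟨D⟩ := HasShiftsAndCones.shift X (-one : Γ)
  obtain ⟨C⟩ := HasShiftsAndCones.cone _ (id_mem_cocycles (Γ := Γ) D.obj)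
  exact ⟨DoubleData.ofCone D C⟩

variable {A} in
/-- A chosen `cone(id_{X[-1]})`. -/
noncomputable def double (X : A) : DoubleData Γ X := (exists_doubleData Γ X).some

/-- The functor `Φ : Z⁰(A) ⥤ Z⁰(A^♭)`, `X ↦ cone(id_{X[-1]})`. -/
noncomputable def phi : Z0 Γ A ⥤ Z0 Γ (Bec Γ A) where
  obj X := ⟨(double Γ X.obj).bec⟩
  map {X Y} f := (double Γ X.obj).becMap (double Γ Y.obj) f
  map_id X := Subtype.ext (Subtype.ext (by
    change (double Γ X.obj).map (double Γ X.obj) (𝟙 X.obj) = 𝟙 _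
    simp [DoubleData.map, (double Γ X.obj).total]))
  map_comp {X Y Z} f g := Subtype.ext (Subtype.ext (by
    change (double Γ X.obj).map (double Γ Z.obj) (f.1 ≫ g.1) =
      (double Γ X.obj).map (double Γ Y.obj) f.1 ≫ (double Γ Y.obj).map (double Γ Z.obj) g.1
    simp [DoubleData.map]))

instance : (phi Γ A).Additive where
  map_add {X Y f g} := Subtype.ext (Subtype.ext (by
    change (double Γ X.obj).map (double Γ Y.obj) (f.1 + g.1) =
      (double Γ X.obj).map (double Γ Y.obj) f.1 + (double Γ X.obj).map (double Γ Y.obj) g.1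
    simp [DoubleData.map]
    abel))

end Functors

section Exact

variable {C : Type u} [Category.{v} C] [Preadditive C]

/-- A morphism which is the first map of a sequence in the given class. -/
def IsInflation (P : ObjectProperty (ShortComplex C)) {X Y : C} (f : X ⟶ Y) : Prop :=
  ∃ (Z : C) (g : Y ⟶ Z) (h : f ≫ g = 0), P (ShortComplex.mk f g h)

/-- A morphism which is the second map of a sequence in the given class. -/
def IsDeflation (P : ObjectProperty (ShortComplex C)) {Y Z : C} (g : Y ⟶ Z) : Prop :=
  ∃ (X : C) (f : X ⟶ Y) (h : f ≫ g = 0), P (ShortComplex.mk f g h)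

/-- An exact structure (in the sense of Quillen) on an additive category. -/
structure ExactStructure (C : Type u) [Category.{v} C] [Preadditive C] where
  conflation : ObjectProperty (ShortComplex C)
  of_iso {S T : ShortComplex C} : (S ≅ T) → conflation S → conflation T
  isKernel (S : ShortComplex C) : conflation S → Nonempty (IsLimit (KernelFork.ofι S.f S.zero))
  isCokernel (S : ShortComplex C) :
    conflation S → Nonempty (IsColimit (CokernelCofork.ofπ S.g S.zero))
  id_inflation (X : C) : IsInflation conflation (𝟙 X)
  id_deflation (X : C) : IsDeflation conflation (𝟙 X)
  comp_inflation {X Y Z : C} (f : X ⟶ Y) (g : Y ⟶ Z) :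
    IsInflation conflation f → IsInflation conflation g → IsInflation conflation (f ≫ g)
  comp_deflation {X Y Z : C} (f : X ⟶ Y) (g : Y ⟶ Z) :
    IsDeflation conflation f → IsDeflation conflation g → IsDeflation conflation (f ≫ g)
  pushout {X Y X' : C} (f : X ⟶ Y) (a : X ⟶ X') : IsInflation conflation f →
    ∃ (Y' : C) (b : Y ⟶ Y') (f' : X' ⟶ Y'), IsPushout f a b f' ∧ IsInflation conflation f'
  pullback {Y Z Z' : C} (g : Y ⟶ Z) (c : Z' ⟶ Z) : IsDeflation conflation g →
    ∃ (Y' : C) (b : Y' ⟶ Y) (g' : Y' ⟶ Z'), IsPullback b g' g c ∧ IsDeflation conflation g'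

namespace ExactStructure

/-- An object such that `Hom(-, J)` takes admissible short exact sequences to
short exact sequences. -/
def IsInjective (ex : ExactStructure C) (J : C) : Prop :=
  ∀ S : ShortComplex C, ex.conflation S →
    Function.Injective (fun h : S.X₃ ⟶ J => S.g ≫ h) ∧
    Function.Exact (fun h : S.X₃ ⟶ J => S.g ≫ h) (fun h : S.X₂ ⟶ J => S.f ≫ h) ∧
    Function.Surjective (fun h : S.X₂ ⟶ J => S.f ≫ h)

/-- An object such that `Hom(P, -)` takes admissible short exact sequences to
short exact sequences. -/
def IsProjective (ex : ExactStructure C) (P : C) : Prop :=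
  ∀ S : ShortComplex C, ex.conflation S →
    Function.Injective (fun h : P ⟶ S.X₁ => h ≫ S.f) ∧
    Function.Exact (fun h : P ⟶ S.X₁ => h ≫ S.f) (fun h : P ⟶ S.X₂ => h ≫ S.g) ∧
    Function.Surjective (fun h : P ⟶ S.X₂ => h ≫ S.g)

end ExactStructure

variable {A : Type u} [Category.{v} A] [Preadditive A] [DGCategory Γ A]

/-- The short sequence in `Z⁰(A)` obtained from `S` by the shift by `[i]`. -/
def shiftSeq {i : Γ} (S : ShortComplex (Z0 Γ A)) (D₁ : ShiftData S.X₁.obj i)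
    (D₂ : ShiftData S.X₂.obj i) (D₃ : ShiftData S.X₃.obj i) : ShortComplex (Z0 Γ A) where
  X₁ := ⟨D₁.obj⟩
  X₂ := ⟨D₂.obj⟩
  X₃ := ⟨D₃.obj⟩
  f := ⟨D₁.t ≫ S.f.1 ≫ D₂.s, shift_mem D₁ D₂ S.f.2⟩
  g := ⟨D₂.t ≫ S.g.1 ≫ D₃.s, shift_mem D₂ D₃ S.g.2⟩
  zero := Subtype.ext (by
    have h : S.f.1 ≫ S.g.1 = 0 := congrArg Subtype.val S.zero
    change (D₁.t ≫ S.f.1 ≫ D₂.s) ≫ D₂.t ≫ S.g.1 ≫ D₃.s = 0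
    simp [reassoc_of% h])

/-- The exact structure is preserved by the shift `[i]`. -/
def ExactStructure.PreservedByShift (ex : ExactStructure (Z0 Γ A)) (i : Γ) : Prop :=
  ∀ (S : ShortComplex (Z0 Γ A)) (D₁ : ShiftData S.X₁.obj i) (D₂ : ShiftData S.X₂.obj i)
    (D₃ : ShiftData S.X₃.obj i), ex.conflation S → ex.conflation (shiftSeq S D₁ D₂ D₃)

end Exact

section ExactDG

/-- The structure of an exact DG-category on an additive DG-category `E` with shifts and cones:
a compatible pair of exact structures on `Z⁰(E)` and `Z⁰(E^♭)`. -/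
structure ExactDGStructure (Γ : Type t) [AddCommGroup Γ] [GradingDatum Γ]
    (E : Type u) [Category.{v} E] [Preadditive E] [DGCategory Γ E] [HasShiftsAndCones Γ E] where
  exact : ExactStructure (Z0 Γ E)
  exactBec : ExactStructure (Z0 Γ (Bec Γ E))
  shift_one : exact.PreservedByShift (one : Γ)
  shift_neg_one : exact.PreservedByShift (-one : Γ)
  bec_shift_one : exactBec.PreservedByShift (one : Γ)
  bec_shift_neg_one : exactBec.PreservedByShift (-one : Γ)
  phi_iff (S : ShortComplex (Z0 Γ E)) :
    exactBec.conflation (S.map (phi Γ E)) ↔ exact.conflation S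
  psi_iff (S : ShortComplex (Z0 Γ (Bec Γ E))) :
    exact.conflation (S.map (psi Γ E)) ↔ exactBec.conflation S

variable {E : Type u} [Category.{v} E] [Preadditive E] [DGCategory Γ E]

variable (Γ) in
/-- `T` is the coproduct of the family `X` in the DG-category `E`: the maps `ι j` are closed of
degree `0` and induce isomorphisms from the complexes `Hom(T, Y)` to the products of the complexes
`Hom(X j, Y)`. -/
structure IsDGCoproduct {J : Type w} (X : J → E) (T : E) (ι : ∀ j, X j ⟶ T) : Prop where
  closed : ∀ j, ι j ∈ cocycles Γ (X j) T
  desc : ∀ (Y : E) (i : Γ) (f : ∀ j, X j ⟶ Y), (∀ j, f j ∈ hom (X j) Y i) →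
    ∃! g : T ⟶ Y, g ∈ hom T Y i ∧ ∀ j, ι j ≫ g = f j

variable (Γ) in
/-- `T` is the product of the family `X` in the DG-category `E`. -/
structure IsDGProduct {J : Type w} (X : J → E) (T : E) (π : ∀ j, T ⟶ X j) : Prop where
  closed : ∀ j, π j ∈ cocycles Γ T (X j)
  lift : ∀ (Y : E) (i : Γ) (f : ∀ j, Y ⟶ X j), (∀ j, f j ∈ hom Y (X j) i) →
    ∃! g : Y ⟶ T, g ∈ hom Y T i ∧ ∀ j, g ≫ π j = f j

/-- The totalization `A[1] ⊕ B ⊕ C[-1]` of a short sequence `A ⟶ B ⟶ C` in `Z⁰(E)`. -/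
structure Totalization (S : ShortComplex (Z0 Γ E)) where
  obj : E
  i₁ : S.X₁.obj ⟶ obj
  i₂ : S.X₂.obj ⟶ obj
  i₃ : S.X₃.obj ⟶ obj
  p₁ : obj ⟶ S.X₁.obj
  p₂ : obj ⟶ S.X₂.obj
  p₃ : obj ⟶ S.X₃.obj
  i₁_mem : i₁ ∈ hom S.X₁.obj obj (-one : Γ)
  i₂_mem : i₂ ∈ hom S.X₂.obj obj (0 : Γ)
  i₃_mem : i₃ ∈ hom S.X₃.obj obj (one : Γ)
  p₁_mem : p₁ ∈ hom obj S.X₁.obj (one : Γ)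
  p₂_mem : p₂ ∈ hom obj S.X₂.obj (0 : Γ)
  p₃_mem : p₃ ∈ hom obj S.X₃.obj (-one : Γ)
  i₁_p₁ : i₁ ≫ p₁ = 𝟙 _
  i₂_p₂ : i₂ ≫ p₂ = 𝟙 _
  i₃_p₃ : i₃ ≫ p₃ = 𝟙 _
  i₁_p₂ : i₁ ≫ p₂ = 0
  i₁_p₃ : i₁ ≫ p₃ = 0
  i₂_p₁ : i₂ ≫ p₁ = 0
  i₂_p₃ : i₂ ≫ p₃ = 0
  i₃_p₁ : i₃ ≫ p₁ = 0
  i₃_p₂ : i₃ ≫ p₂ = 0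
  total : p₁ ≫ i₁ + p₂ ≫ i₂ + p₃ ≫ i₃ = 𝟙 obj
  d_i₁ : d Γ i₁ = S.f.1 ≫ i₂
  d_i₂ : d Γ i₂ = S.g.1 ≫ i₃
  d_i₃ : d Γ i₃ = 0

variable [HasShiftsAndCones Γ E]

namespace ExactDGStructure

variable (ex : ExactDGStructure Γ E)

/-- The exact DG-category has exact coproducts. -/
structure HasExactCoproducts : Prop where
  exists_coproduct : ∀ (J : Type w) (X : J → E), ∃ (T : E) (ι : ∀ j, X j ⟶ T),
    IsDGCoproduct Γ X T ι
  exact : ∀ (J : Type w) (S : J → ShortComplex (Z0 Γ E)) (T : ShortComplex (Z0 Γ E))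
    (φ : ∀ j, S j ⟶ T),
    Nonempty (IsColimit (Cofan.mk T.X₁ (fun j => (φ j).τ₁))) →
    Nonempty (IsColimit (Cofan.mk T.X₂ (fun j => (φ j).τ₂))) →
    Nonempty (IsColimit (Cofan.mk T.X₃ (fun j => (φ j).τ₃))) →
    (∀ j, ex.exact.conflation (S j)) → ex.exact.conflation T

/-- The exact DG-category has exact products. -/
structure HasExactProducts : Prop where
  exists_product : ∀ (J : Type w) (X : J → E), ∃ (T : E) (π : ∀ j, T ⟶ X j),
    IsDGProduct Γ X T π
  exact : ∀ (J : Type w) (S : J → ShortComplex (Z0 Γ E)) (T : ShortComplex (Z0 Γ E))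
    (φ : ∀ j, T ⟶ S j),
    Nonempty (IsLimit (Fan.mk T.X₁ (fun j => (φ j).τ₁))) →
    Nonempty (IsLimit (Fan.mk T.X₂ (fun j => (φ j).τ₂))) →
    Nonempty (IsLimit (Fan.mk T.X₃ (fun j => (φ j).τ₃))) →
    (∀ j, ex.exact.conflation (S j)) → ex.exact.conflation T

/-- The full triangulated subcategories of `H⁰(E)` containing the totalizations of
the admissible short exact sequences. -/
structure ContainsAcyclic (P : ObjectProperty (H0 Γ E)) : Prop where
  triangulated : P.IsTriangulated
  iso : P.IsClosedUnderIsomorphisms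
  totalization : ∀ S, ex.exact.conflation S → ∀ T : Totalization S, P ⟨T.obj⟩

/-- The coacyclic objects: the minimal full triangulated subcategory of `H⁰(E)` containing the
totalizations of the admissible short exact sequences and closed under coproducts. -/
def coacyclic : ObjectProperty (H0 Γ E) := fun X =>
  ∀ P : ObjectProperty (H0 Γ E), ex.ContainsAcyclic P →
    (∀ J : Type w, P.IsClosedUnderColimitsOfShape (Discrete J)) → P X

/-- The contraacyclic objects: the minimal full triangulated subcategory of `H⁰(E)` containing the
totalizations of the admissible short exact sequences and closed under products. -/
def contraacyclic : ObjectProperty (H0 Γ E) := fun X =>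
  ∀ P : ObjectProperty (H0 Γ E), ex.ContainsAcyclic P →
    (∀ J : Type w, P.IsClosedUnderLimitsOfShape (Discrete J)) → P X

/-- An intersection of strictly full triangulated subcategories. -/
lemma isTriangulated_inter {C : Type u} [Category.{v} C] [Preadditive C] [HasZeroObject C]
    [HasShift C ℤ] [∀ n : ℤ, (shiftFunctor C n).Additive] [Pretriangulated C]
    (R : ObjectProperty C → Prop)
    (hR : ∀ P, R P → P.IsTriangulated ∧ P.IsClosedUnderIsomorphisms) :
    ObjectProperty.IsTriangulated (fun X : C => ∀ P : ObjectProperty C, R P → P X) where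
  exists_zero := by
    obtain ⟨Z, hZ⟩ := HasZeroObject.zero (C := C)
    refine ⟨Z, hZ, fun P hP => ?_⟩
    have := (hR P hP).1
    have := (hR P hP).2
    obtain ⟨W, hW, h⟩ := P.exists_prop_of_containsZero
    exact P.prop_of_iso (hW.iso hZ) h
  isStableUnderShiftBy n := ⟨fun X hX P hP => by
    have := (hR P hP).1
    exact P.le_shift n X (hX P hP)⟩
  ext₂' T hT h₁ h₃ := ObjectProperty.le_isoClosure _ _ (fun P hP => by
    have := (hR P hP).1
    have := (hR P hP).2
    exact P.ext_of_isTriangulatedClosed₂ T hT (h₁ P hP) (h₃ P hP))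

instance : (coacyclic.{w} ex).IsTriangulated := by
  have h := isTriangulated_inter (C := H0 Γ E) (fun P => ex.ContainsAcyclic P ∧
    (∀ J : Type w, P.IsClosedUnderColimitsOfShape (Discrete J)))
    (fun P hP => ⟨hP.1.1, hP.1.2⟩)
  convert h using 1
  funext X
  simp [coacyclic]

instance : (contraacyclic.{w} ex).IsTriangulated := by
  have h := isTriangulated_inter (C := H0 Γ E) (fun P => ex.ContainsAcyclic P ∧
    (∀ J : Type w, P.IsClosedUnderLimitsOfShape (Discrete J)))
    (fun P hP => ⟨hP.1.1, hP.1.2⟩)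
  convert h using 1
  funext X
  simp [contraacyclic]

/-- The coderived category `H⁰(E) / Ac^co(E)`. -/
abbrev Coderived := (coacyclic.{w} ex).trW.Localization

/-- The contraderived category `H⁰(E) / Ac^ctr(E)`. -/
abbrev Contraderived := (contraacyclic.{w} ex).trW.Localization

/-- The Verdier quotient functor to the coderived category. -/
abbrev toCoderived : H0 Γ E ⥤ Coderived.{w} ex := (coacyclic.{w} ex).trW.Q

/-- The Verdier quotient functor to the contraderived category. -/
abbrev toContraderived : H0 Γ E ⥤ Contraderived.{w} ex := (contraacyclic.{w} ex).trW.Q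

/-- The graded-injective objects, as a full subcategory of `H⁰(E)`. -/
def gradedInjective : ObjectProperty (H0 Γ E) := fun J =>
  ex.exactBec.IsInjective ((phi Γ E).obj ⟨J.obj⟩)

/-- The graded-projective objects, as a full subcategory of `H⁰(E)`. -/
def gradedProjective : ObjectProperty (H0 Γ E) := fun P =>
  ex.exactBec.IsProjective ((phi Γ E).obj ⟨P.obj⟩)

end ExactDGStructure

end ExactDG

end DG

/-! ### Morphisms in `Z⁰(A^♭)` into and out of cones of identities. -/

namespace DG

open DGCategory

variable {Γ : Type t} [AddCommGroup Γ] [GradingDatum Γ]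

section Bec

variable {A : Type u} [Category.{v} A] [Preadditive A] [DGCategory Γ A]

/-! Everything rests on a description of the morphisms into `Φ(J)`. A morphism `F` from `(X, σ)` to
`Φ(J)` in `Z⁰(A^♭)` is determined by its component `b = F ≫ π'`, since differentiating gives `F ≫ π
= d b`. The components that occur are exactly the `b : X ⟶ J` of degree `-one` with `σ ≫ b = 0`.
Hence graded-injectivity of `J` is an extension property for such `b` along inflations of `Z⁰(E^♭)`
(`gradedInjective_iff`). The differential of `J` plays no role in it, so it passes to shifts and
cones, and the graded-injective objects form a triangulated subcategory.

Let `S` be a conflation of `Z⁰(E)`. Applying the extension property to `Φ(S)` shows that `Hom(-, J)`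
turns `S` into a short exact sequence of complexes in the degrees that are needed
(`exists_f_comp_eq`, `exists_g_comp_eq`, `eq_zero_of_g_comp`). Only the extension step needs
injectivity; the other two express that the deflation is a cokernel. The complex of morphisms from
the totalization of `S` to `J` is the total complex of this short exact sequence, so a closed
morphism of degree `0` is null-homotopic, by a short diagram chase (`totalization_comp_eq_zero`).

The objects of `H⁰(E)` with no nonzero morphism to a graded-injective object form a strictly full
triangulated subcategory closed under coproducts. It contains these totalizations, hence by
minimality all coacyclic objects. Finally, a morphism `X' ⟶ X` with coacyclic cone induces a
bijection from `Hom(X, J)` to `Hom(X', J)`, so every fraction with target `J` comes from a unique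
morphism of `H⁰(E)`. This is full faithfulness.

The case of products is dual, but `Φ` is not symmetric in its degrees: a morphism out of `Φ(P)` is
determined by `v = ι' ≫ F`, of degree `0`, with `v ≫ σ = 0`. -/

lemma comp_d_of_closed {X Y Z : A} {f : X ⟶ Y} (hf : d Γ f = 0) (g : Y ⟶ Z) :
    d Γ (f ≫ g) = f ≫ d Γ g := by
  simp [leibniz_sign, hf]

lemma d_comp_of_closed {X Y Z : A} {f : X ⟶ Y} {g : Y ⟶ Z} (hg : g ∈ cocycles Γ Y Z) :
    d Γ (f ≫ g) = d Γ f ≫ g := by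
  have h : d Γ g = 0 := hg.2
  simp [leibniz f g hg.1, h, sgn_zero]

namespace Bec

lemma val_mem {X Y : Z0 Γ (Bec Γ A)} (F : X ⟶ Y) : F.1.1 ∈ cocycles Γ X.obj.obj Y.obj.obj :=
  ((psi Γ A).map F).2

lemma val_comm {X Y : Z0 Γ (Bec Γ A)} (F : X ⟶ Y) :
    F.1.1 ≫ Y.obj.σ = X.obj.σ ≫ F.1.1 := by
  have h : F.1.1 ≫ Y.obj.σ - X.obj.σ ≫ sign Γ _ _ F.1.1 = 0 := congrArg Subtype.val F.2.2
  rwa [sign_of_mem (val_mem F).1, sgn_zero, one_smul, sub_eq_zero] at h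

/-- A morphism in `Z⁰(A^♭)` from a closed morphism of degree `0` commuting with the
contracting homotopies. -/
def homMk {X Y : Bec Γ A} (f : X.obj ⟶ Y.obj) (hf : f ∈ cocycles Γ X.obj Y.obj)
    (comm : f ≫ Y.σ = X.σ ≫ f) : (⟨X⟩ : Z0 Γ (Bec Γ A)) ⟶ ⟨Y⟩ :=
  ⟨⟨f, hf.2⟩, by
    change f ∈ hom X.obj Y.obj (-0 : Γ)
    rw [neg_zero]
    exact hf.1, by
    refine Subtype.ext ?_
    change f ≫ Y.σ - X.σ ≫ sign Γ _ _ f = 0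
    rw [sign_of_mem hf.1, sgn_zero, one_smul, sub_eq_zero, comm]⟩

lemma hom_ext {X Y : Z0 Γ (Bec Γ A)} {F G : X ⟶ Y} (h : F.1.1 = G.1.1) : F = G :=
  Subtype.ext (Subtype.ext h)

/-- Differentiate `σ ≫ b = 0` and use `d σ = 𝟙`. The outcome is what makes the lift of `b` to a cone
commute with the contracting homotopies. -/
lemma σ_comp_d {X : Bec Γ A} {J : A} {b : X.obj ⟶ J} (h : X.σ ≫ b = 0) {i : Γ}
    (hb : b ∈ hom X.obj J i) : X.σ ≫ d Γ b = -(sgn i • b) := by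
  have e := leibniz X.σ b hb
  rw [h, map_zero, X.d_σ, Category.id_comp] at e
  exact eq_neg_of_add_eq_zero_left e.symm

lemma d_comp_σ {X : Bec Γ A} {P : A} {v : P ⟶ X.obj} (h : v ≫ X.σ = 0) :
    d Γ v ≫ X.σ = v := by
  have e := leibniz v X.σ X.σ_mem
  rw [h, map_zero, X.d_σ, Category.comp_id, sgn_neg, sgn_one, neg_one_smul] at e
  exact (eq_of_sub_eq_zero (by rw [sub_eq_add_neg, ← e])).symm

/-- The shift of an object of `A^♭`, over a given shift in `A`. -/
def shift (X : Bec Γ A) {j : Γ} (D : ShiftData X.obj j) : Bec Γ A where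
  obj := D.obj
  -- The sign cancels the one that the Leibniz rule produces on passing `D.s`, of degree `-j`, so
  -- that the differential is the identity.
  σ := sgn j • (D.t ≫ X.σ ≫ D.s)
  σ_mem := zsmul_mem (comp_mem' D.t_mem (comp_mem X.σ_mem D.s_mem) (by abel)) _
  d_σ := by
    rw [map_zsmul, comp_d_of_closed D.d_t, leibniz _ _ D.s_mem, D.d_s, X.d_σ, sgn_neg]
    simp [smul_smul, sgn_mul_self]
  σ_σ := by
    have h := X.σ_σ
    simp [reassoc_of% h]

/-- The shift of a sequence in `Z⁰(A^♭)`, over given shifts in `A`. -/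
def shiftSeq (S : ShortComplex (Z0 Γ (Bec Γ A))) {j : Γ} (D₁ : ShiftData S.X₁.obj.obj j)
    (D₂ : ShiftData S.X₂.obj.obj j) (D₃ : ShiftData S.X₃.obj.obj j) :
    ShortComplex (Z0 Γ (Bec Γ A)) where
  X₁ := ⟨S.X₁.obj.shift D₁⟩
  X₂ := ⟨S.X₂.obj.shift D₂⟩
  X₃ := ⟨S.X₃.obj.shift D₃⟩
  f := homMk (X := S.X₁.obj.shift D₁) (Y := S.X₂.obj.shift D₂) (D₁.t ≫ S.f.1.1 ≫ D₂.s)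
    (shift_mem D₁ D₂ (val_mem S.f)) (by
      have h := val_comm S.f
      simp [shift, reassoc_of% h])
  g := homMk (X := S.X₂.obj.shift D₂) (Y := S.X₃.obj.shift D₃) (D₂.t ≫ S.g.1.1 ≫ D₃.s)
    (shift_mem D₂ D₃ (val_mem S.g)) (by
      have h := val_comm S.g
      simp [shift, reassoc_of% h])
  zero := hom_ext (by
    have h : S.f.1.1 ≫ S.g.1.1 = 0 := congrArg (fun F => F.1.1) S.zero
    change (D₁.t ≫ S.f.1.1 ≫ D₂.s) ≫ D₂.t ≫ S.g.1.1 ≫ D₃.s = 0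
    simp [reassoc_of% h])

end Bec

namespace DoubleData

variable {J : A} (D : DoubleData Γ J)

/-- The underlying morphism of a morphism to `cone(id_{J[-1]})`. -/
def toVal {X : Z0 Γ (Bec Γ A)} (F : X ⟶ ⟨D.bec⟩) : X.obj.obj ⟶ D.obj := F.1.1

/-- The underlying morphism of a morphism from `cone(id_{J[-1]})`. -/
def ofVal {X : Z0 Γ (Bec Γ A)} (F : (⟨D.bec⟩ : Z0 Γ (Bec Γ A)) ⟶ X) : D.obj ⟶ X.obj.obj := F.1.1

lemma toVal_mem {X : Z0 Γ (Bec Γ A)} (F : X ⟶ ⟨D.bec⟩) :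
    D.toVal F ∈ cocycles Γ X.obj.obj D.obj := Bec.val_mem F

lemma ofVal_mem {X : Z0 Γ (Bec Γ A)} (F : (⟨D.bec⟩ : Z0 Γ (Bec Γ A)) ⟶ X) :
    D.ofVal F ∈ cocycles Γ D.obj X.obj.obj := Bec.val_mem F

lemma toVal_comm {X : Z0 Γ (Bec Γ A)} (F : X ⟶ ⟨D.bec⟩) :
    D.toVal F ≫ D.π' ≫ D.ι' = X.obj.σ ≫ D.toVal F := Bec.val_comm F

lemma ofVal_comm {X : Z0 Γ (Bec Γ A)} (F : (⟨D.bec⟩ : Z0 Γ (Bec Γ A)) ⟶ X) :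
    D.ofVal F ≫ X.obj.σ = D.π' ≫ D.ι' ≫ D.ofVal F :=
  (Bec.val_comm F).trans (Category.assoc D.π' D.ι' (D.ofVal F))

/-- Since `d π' = π`, for closed `f` the component `f ≫ π` is the differential of `f ≫ π'`, and the
two components together determine `f`. -/
lemma eq_of_comp_π' {Z : A} {f g : Z ⟶ D.obj} (hf : d Γ f = 0) (hg : d Γ g = 0)
    (h : f ≫ D.π' = g ≫ D.π') : f = g := by
  have ef := comp_d_of_closed hf D.π'
  have eg := comp_d_of_closed hg D.π'
  rw [h, eg] at ef
  simp only [d_π'] at ef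
  rw [← Category.comp_id f, ← Category.comp_id g, ← D.total]
  simp [reassoc_of% h, reassoc_of% ef]

/-- Since `d ι' = ι`, the restriction of `f` along `ι` is the differential of its restriction along
`ι'`. -/
lemma eq_of_ι'_comp {Z : A} {f g : D.obj ⟶ Z} (hf : f ∈ cocycles Γ D.obj Z)
    (hg : g ∈ cocycles Γ D.obj Z) (h : D.ι' ≫ f = D.ι' ≫ g) : f = g := by
  have ef := d_comp_of_closed (f := D.ι') hf
  have eg := d_comp_of_closed (f := D.ι') hg
  rw [h, eg] at ef
  simp only [d_ι'] at ef
  rw [← Category.id_comp f, ← Category.id_comp g, ← D.total]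
  simp [h, ef]

lemma toVal_injective {X : Z0 Γ (Bec Γ A)} {F G : X ⟶ ⟨D.bec⟩}
    (h : D.toVal F ≫ D.π' = D.toVal G ≫ D.π') : F = G :=
  Bec.hom_ext (D.eq_of_comp_π' (D.toVal_mem F).2 (D.toVal_mem G).2 h)

lemma ofVal_injective {X : Z0 Γ (Bec Γ A)} {F G : (⟨D.bec⟩ : Z0 Γ (Bec Γ A)) ⟶ X}
    (h : D.ι' ≫ D.ofVal F = D.ι' ≫ D.ofVal G) : F = G :=
  Bec.hom_ext (D.eq_of_ι'_comp (D.ofVal_mem F) (D.ofVal_mem G) h)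

lemma σ_comp_toVal_π' {X : Z0 Γ (Bec Γ A)} (F : X ⟶ ⟨D.bec⟩) :
    X.obj.σ ≫ D.toVal F ≫ D.π' = 0 := by
  have e := D.toVal_comm F
  rw [← reassoc_of% e]
  simp

lemma ι'_ofVal_comp_σ {X : Z0 Γ (Bec Γ A)} (F : (⟨D.bec⟩ : Z0 Γ (Bec Γ A)) ⟶ X) :
    (D.ι' ≫ D.ofVal F) ≫ X.obj.σ = 0 := by
  rw [Category.assoc, D.ofVal_comm]
  simp

/-- This is the only possible closed lift of `b` through `π'`: its other component has to be `d b`.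
The two contributions `d b ≫ ι` to the differential cancel because `ι` is odd. -/
lemma lift_mem {Z : A} {b : Z ⟶ J} (hb : b ∈ hom Z J (-one : Γ)) :
    b ≫ D.ι + d Γ b ≫ D.ι' ∈ cocycles Γ Z D.obj := by
  refine ⟨add_mem (comp_mem' hb D.ι_mem (by abel)) (comp_mem' (d_mem hb) D.ι'_mem (by abel)), ?_⟩
  change d Γ _ = 0
  simp [leibniz _ _ D.ι_mem, leibniz _ _ D.ι'_mem, sgn_one, d_d]

lemma desc_mem {Z : A} {v : J ⟶ Z} (hv : v ∈ hom J Z (0 : Γ)) :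
    D.π' ≫ d Γ v + D.π ≫ v ∈ cocycles Γ D.obj Z := by
  refine ⟨add_mem (comp_mem' D.π'_mem (d_mem hv) (by abel)) (comp_mem' D.π_mem hv (by abel)), ?_⟩
  change d Γ _ = 0
  simp [leibniz _ _ hv, leibniz _ _ (d_mem hv), sgn_one, sgn_zero, d_d]

/-- Together with `toVal_injective` and `σ_comp_toVal_π'`, this identifies the morphisms to `Φ(J)`
with the degree `-one` morphisms to `J` killed by `σ`. In that degree `σ ≫ d b = b`, which is the
compatibility with the homotopies. -/
lemma exists_toVal {X : Z0 Γ (Bec Γ A)} {b : X.obj.obj ⟶ J}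
    (hb : b ∈ hom X.obj.obj J (-one : Γ)) (h : X.obj.σ ≫ b = 0) :
    ∃ F : X ⟶ ⟨D.bec⟩, D.toVal F ≫ D.π' = b := by
  have e : X.obj.σ ≫ d Γ b = b := by simp [Bec.σ_comp_d h hb, sgn_neg, sgn_one]
  have comm : (b ≫ D.ι + d Γ b ≫ D.ι') ≫ D.π' ≫ D.ι' =
      X.obj.σ ≫ (b ≫ D.ι + d Γ b ≫ D.ι') := by
    simp [reassoc_of% h, reassoc_of% e]
  have e' : (b ≫ D.ι + d Γ b ≫ D.ι') ≫ D.π' = b := by simp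
  exact ⟨Bec.homMk (Y := D.bec) _ (D.lift_mem hb) comm, e'⟩

/-- The dual identification: morphisms out of `Φ(J)` are the degree `0` morphisms out of `J` whose
composition with `σ` vanishes. -/
lemma exists_ofVal {X : Z0 Γ (Bec Γ A)} {v : J ⟶ X.obj.obj}
    (hv : v ∈ hom J X.obj.obj (0 : Γ)) (h : v ≫ X.obj.σ = 0) :
    ∃ F : (⟨D.bec⟩ : Z0 Γ (Bec Γ A)) ⟶ X, D.ι' ≫ D.ofVal F = v := by
  have e := Bec.d_comp_σ h
  have comm : (D.π' ≫ d Γ v + D.π ≫ v) ≫ X.obj.σ =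
      (D.π' ≫ D.ι') ≫ (D.π' ≫ d Γ v + D.π ≫ v) := by
    simp [h, e]
  have e' : D.ι' ≫ (D.π' ≫ d Γ v + D.π ≫ v) = v := by simp
  exact ⟨Bec.homMk (X := D.bec) _ (D.desc_mem hv) comm, e'⟩

variable {K : A} (E : DoubleData Γ K)

@[simp] lemma map_π' (f : J ⟶ K) : D.map E f ≫ E.π' = D.π' ≫ f := by simp [map]

@[simp] lemma map_π (f : J ⟶ K) : D.map E f ≫ E.π = D.π ≫ f := by simp [map]

@[simp] lemma ι_map (f : J ⟶ K) : D.ι ≫ D.map E f = f ≫ E.ι := by simp [map]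

@[simp] lemma ι'_map (f : J ⟶ K) : D.ι' ≫ D.map E f = f ≫ E.ι' := by simp [map]

end DoubleData

end Bec

end DG
-- Graded-injective and graded-projective objects form triangulated subcategories.
namespace DG

open DGCategory

variable {Γ : Type t} [AddCommGroup Γ] [GradingDatum Γ]

namespace ExactStructure

variable {C : Type u} [Category.{v} C] [Preadditive C] (ex : ExactStructure C)

/-- A conflation is a cokernel sequence, so left exactness of `Hom(-, J)` is automatic and only
extension along the inflation is a condition. -/
lemma isInjective_iff (J : C) :
    ex.IsInjective J ↔ ∀ S : ShortComplex C, ex.conflation S →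
      ∀ a : S.X₁ ⟶ J, ∃ b : S.X₂ ⟶ J, S.f ≫ b = a := by
  refine ⟨fun h S hS => (h S hS).2.2, fun h S hS => ⟨fun a b hab => ?_, fun a => ⟨fun ha => ?_, ?_⟩,
    h S hS⟩⟩
  · obtain ⟨hc⟩ := ex.isCokernel S hS
    exact Cofork.IsColimit.hom_ext hc hab
  · obtain ⟨hc⟩ := ex.isCokernel S hS
    exact ⟨hc.desc (CokernelCofork.ofπ a ha), hc.fac (CokernelCofork.ofπ a ha) .one⟩
  · rintro ⟨b, rfl⟩
    simp

lemma isProjective_iff (P : C) :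
    ex.IsProjective P ↔ ∀ S : ShortComplex C, ex.conflation S →
      ∀ a : P ⟶ S.X₃, ∃ b : P ⟶ S.X₂, b ≫ S.g = a := by
  refine ⟨fun h S hS => (h S hS).2.2, fun h S hS => ⟨fun a b hab => ?_, fun a => ⟨fun ha => ?_, ?_⟩,
    h S hS⟩⟩
  · obtain ⟨hc⟩ := ex.isKernel S hS
    exact Fork.IsLimit.hom_ext hc hab
  · obtain ⟨hc⟩ := ex.isKernel S hS
    exact ⟨hc.lift (KernelFork.ofι a ha), hc.fac (KernelFork.ofι a ha) .zero⟩
  · rintro ⟨b, rfl⟩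
    simp

end ExactStructure

namespace ExactDGStructure

variable {E : Type u} [Category.{v} E] [Preadditive E] [DGCategory Γ E] [HasShiftsAndCones Γ E]
  (ex : ExactDGStructure Γ E)

/-- Morphisms of degree `i` to `J` annihilated by the contracting homotopies extend along
inflations in `Z⁰(E^♭)`. -/
def IsInjectiveAt (J : E) (i : Γ) : Prop :=
  ∀ S : ShortComplex (Z0 Γ (Bec Γ E)), ex.exactBec.conflation S →
    ∀ b : S.X₁.obj.obj ⟶ J, b ∈ hom S.X₁.obj.obj J i → S.X₁.obj.σ ≫ b = 0 →
      ∃ b' ∈ hom S.X₂.obj.obj J i, S.X₂.obj.σ ≫ b' = 0 ∧ S.f.1.1 ≫ b' = b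

/-- Morphisms of degree `i` from `P` annihilated by the contracting homotopies lift along
deflations in `Z⁰(E^♭)`. -/
def IsProjectiveAt (P : E) (i : Γ) : Prop :=
  ∀ S : ShortComplex (Z0 Γ (Bec Γ E)), ex.exactBec.conflation S →
    ∀ b : P ⟶ S.X₃.obj.obj, b ∈ hom P S.X₃.obj.obj i → b ≫ S.X₃.obj.σ = 0 →
      ∃ b' ∈ hom P S.X₂.obj.obj i, b' ≫ S.X₂.obj.σ = 0 ∧ b' ≫ S.g.1.1 = b

variable {ex}

/-- Translate extension problems for morphisms to `Φ(J)` through the bijection `F ↦ F ≫ π'`; the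
degree `-one` is that of `π'`. -/
lemma gradedInjective_iff (J : H0 Γ E) :
    ex.gradedInjective J ↔ ex.IsInjectiveAt J.obj (-one : Γ) := by
  let D := double Γ J.obj
  refine (ex.exactBec.isInjective_iff (⟨D.bec⟩ : Z0 Γ (Bec Γ E))).trans
    ⟨fun H S hS b hb h => ?_, fun H S hS a => ?_⟩
  · obtain ⟨F, hF⟩ := D.exists_toVal hb h
    obtain ⟨G, hG⟩ := H S hS F
    refine ⟨D.toVal G ≫ D.π', comp_mem' (D.toVal_mem G).1 D.π'_mem (zero_add _),
      D.σ_comp_toVal_π' G, ?_⟩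
    rw [← hF, ← hG, ← Category.assoc]
    rfl
  · obtain ⟨b, hb, h, e⟩ := H S hS (D.toVal a ≫ D.π')
      (comp_mem' (D.toVal_mem a).1 D.π'_mem (zero_add _)) (D.σ_comp_toVal_π' a)
    obtain ⟨G, hG⟩ := D.exists_toVal hb h
    refine ⟨G, D.toVal_injective ?_⟩
    rw [← e, ← hG, ← Category.assoc]
    rfl

/-- Translate lifting problems through `F ↦ ι' ≫ F`; the degree `0` is that of `ι'`. -/
lemma gradedProjective_iff (P : H0 Γ E) :
    ex.gradedProjective P ↔ ex.IsProjectiveAt P.obj (0 : Γ) := by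
  let D := double Γ P.obj
  refine (ex.exactBec.isProjective_iff (⟨D.bec⟩ : Z0 Γ (Bec Γ E))).trans
    ⟨fun H S hS b hb h => ?_, fun H S hS a => ?_⟩
  · obtain ⟨F, hF⟩ := D.exists_ofVal hb h
    obtain ⟨G, hG⟩ := H S hS F
    refine ⟨D.ι' ≫ D.ofVal G, comp_mem' D.ι'_mem (D.ofVal_mem G).1 (zero_add _),
      D.ι'_ofVal_comp_σ G, ?_⟩
    rw [← hF, ← hG, Category.assoc]
    rfl
  · obtain ⟨b, hb, h, e⟩ := H S hS (D.ι' ≫ D.ofVal a)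
      (comp_mem' D.ι'_mem (D.ofVal_mem a).1 (zero_add _)) (D.ι'_ofVal_comp_σ a)
    obtain ⟨G, hG⟩ := D.exists_ofVal hb h
    refine ⟨G, D.ofVal_injective ?_⟩
    rw [← e, ← hG, Category.assoc]
    rfl

/-- `Ψ⁺` preserves and reflects conflations and carries this sequence to the shift of its image, so
shift invariance in `Z⁰(E)` is enough. -/
lemma conflation_shiftSeq {j : Γ} (hj : ex.exact.PreservedByShift j)
    {S : ShortComplex (Z0 Γ (Bec Γ E))} (hS : ex.exactBec.conflation S)
    (D₁ : ShiftData S.X₁.obj.obj j) (D₂ : ShiftData S.X₂.obj.obj j)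
    (D₃ : ShiftData S.X₃.obj.obj j) : ex.exactBec.conflation (Bec.shiftSeq S D₁ D₂ D₃) :=
  (ex.psi_iff _).1 (hj (S.map (psi Γ E)) D₁ D₂ D₃ ((ex.psi_iff S).2 hS))

/-- Composing with the degree `j` isomorphisms `t` turns a problem in degree `i` for `S` into one in
degree `j + i` for the shift of `S`. -/
lemma IsInjectiveAt.of_shift {J : E} {i j : Γ} (hj : ex.exact.PreservedByShift j)
    (H : ex.IsInjectiveAt J (j + i)) : ex.IsInjectiveAt J i := by
  intro S hS b hb h
  obtain ⟨D₁⟩ := HasShiftsAndCones.shift S.X₁.obj.obj j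
  obtain ⟨D₂⟩ := HasShiftsAndCones.shift S.X₂.obj.obj j
  obtain ⟨D₃⟩ := HasShiftsAndCones.shift S.X₃.obj.obj j
  obtain ⟨b', hb', h', e⟩ := H _ (conflation_shiftSeq hj hS D₁ D₂ D₃) (D₁.t ≫ b)
    (comp_mem D₁.t_mem hb) (by simp [Bec.shiftSeq, Bec.shift, h]; rfl)
  change D₂.obj ⟶ J at b'
  change (sgn j • (D₂.t ≫ S.X₂.obj.σ ≫ D₂.s)) ≫ b' = 0 at h'
  change (D₁.t ≫ S.f.1.1 ≫ D₂.s) ≫ b' = D₁.t ≫ b at e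
  refine ⟨D₂.s ≫ b', comp_mem' D₂.s_mem hb' (by abel), ?_, ?_⟩
  -- Multiplying by `sgn j` once more removes the sign in the shifted homotopy, as its square is
  -- one.
  · have e₁ := congrArg (fun x => sgn j • (D₂.s ≫ x)) h'
    simpa [smul_smul, sgn_mul_self] using e₁
  · simpa using congrArg (fun x => D₁.s ≫ x) e

lemma IsProjectiveAt.of_shift {P : E} {i j : Γ} (hj : ex.exact.PreservedByShift j)
    (H : ex.IsProjectiveAt P (i - j)) : ex.IsProjectiveAt P i := by
  intro S hS b hb h
  obtain ⟨D₁⟩ := HasShiftsAndCones.shift S.X₁.obj.obj j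
  obtain ⟨D₂⟩ := HasShiftsAndCones.shift S.X₂.obj.obj j
  obtain ⟨D₃⟩ := HasShiftsAndCones.shift S.X₃.obj.obj j
  obtain ⟨b', hb', h', e⟩ := H _ (conflation_shiftSeq hj hS D₁ D₂ D₃) (b ≫ D₃.s)
    (comp_mem' hb D₃.s_mem (by abel)) (by simp [Bec.shiftSeq, Bec.shift, reassoc_of% h]; rfl)
  change P ⟶ D₂.obj at b'
  change b' ≫ (sgn j • (D₂.t ≫ S.X₂.obj.σ ≫ D₂.s)) = 0 at h'
  change b' ≫ (D₂.t ≫ S.g.1.1 ≫ D₃.s) = b ≫ D₃.s at e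
  refine ⟨b' ≫ D₂.t, comp_mem' hb' D₂.t_mem (by abel), ?_, ?_⟩
  · have e₁ := congrArg (fun x => sgn j • (x ≫ D₂.t)) h'
    simpa [smul_smul, sgn_mul_self] using e₁
  · simpa using congrArg (fun x => x ≫ D₃.t) e

lemma IsInjectiveAt.add_zsmul {J : E} {i : Γ} (H : ex.IsInjectiveAt J i) (n : ℤ) :
    ex.IsInjectiveAt J (i + n • (one : Γ)) := by
  induction n with
  | zero => simpa using H
  | succ n h => exact .of_shift ex.shift_neg_one (by convert h using 1; rw [add_smul]; simp; abel)
  | pred n h => exact .of_shift ex.shift_one (by convert h using 1; rw [sub_smul]; simp; abel)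

lemma IsProjectiveAt.add_zsmul {P : E} {i : Γ} (H : ex.IsProjectiveAt P i) (n : ℤ) :
    ex.IsProjectiveAt P (i + n • (one : Γ)) := by
  induction n with
  | zero => simpa using H
  | succ n h => exact .of_shift ex.shift_one (by convert h using 1; rw [add_smul]; simp; abel)
  | pred n h => exact .of_shift ex.shift_neg_one (by convert h using 1; rw [sub_smul]; simp; abel)

/-- Here the target is shifted instead of the sequence: `t` and `s` are inverse to each other, so
only degrees change. -/
lemma IsInjectiveAt.of_shiftData {J : E} {i j k : Γ} (H : ex.IsInjectiveAt J k)
    (D : ShiftData J j) (hk : i + j = k) : ex.IsInjectiveAt D.obj i := by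
  intro S hS b hb h
  obtain ⟨b', hb', h', e⟩ := H S hS (b ≫ D.t) (comp_mem' hb D.t_mem hk) (by simp [reassoc_of% h])
  refine ⟨b' ≫ D.s, comp_mem' hb' D.s_mem (by rw [← hk]; abel), by simp [reassoc_of% h'], ?_⟩
  rw [reassoc_of% e]
  simp

lemma IsProjectiveAt.of_shiftData {P : E} {i j k : Γ} (H : ex.IsProjectiveAt P k)
    (D : ShiftData P j) (hk : j + k = i) : ex.IsProjectiveAt D.obj i := by
  intro S hS b hb h
  obtain ⟨b', hb', h', e⟩ := H S hS (D.s ≫ b) (comp_mem' D.s_mem hb (by rw [← hk]; abel))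
    (by simp [h])
  exact ⟨D.t ≫ b', comp_mem' D.t_mem hb' hk, by simp [h'], by simp [e]⟩

/-- The extension property ignores the differential of the target, and without it the cone is just
`X[1] ⊕ Y`. The two components are extended separately, whatever `f` is. -/
lemma IsInjectiveAt.cone {X Y : E} {f : X ⟶ Y} (C : ConeData Γ f) {i j : Γ} (hij : i + one = j)
    (hX : ex.IsInjectiveAt X j) (hY : ex.IsInjectiveAt Y i) : ex.IsInjectiveAt C.obj i := by
  intro S hS b hb h
  obtain ⟨b₁, hb₁, h₁, e₁⟩ := hX S hS (b ≫ C.fst) (comp_mem' hb C.fst_mem hij)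
    (by simp [reassoc_of% h])
  obtain ⟨b₂, hb₂, h₂, e₂⟩ := hY S hS (b ≫ C.snd) (comp_mem' hb C.snd_mem (add_zero _))
    (by simp [reassoc_of% h])
  refine ⟨b₁ ≫ C.inl + b₂ ≫ C.inr, add_mem (comp_mem' hb₁ C.inl_mem (by rw [← hij]; abel))
    (comp_mem' hb₂ C.inr_mem (add_zero _)), by simp [reassoc_of% h₁, reassoc_of% h₂], ?_⟩
  rw [Preadditive.comp_add, reassoc_of% e₁, reassoc_of% e₂, ← Preadditive.comp_add, C.total,
    Category.comp_id]

lemma IsProjectiveAt.cone {X Y : E} {f : X ⟶ Y} (C : ConeData Γ f) {i j : Γ} (hij : j + one = i)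
    (hX : ex.IsProjectiveAt X j) (hY : ex.IsProjectiveAt Y i) : ex.IsProjectiveAt C.obj i := by
  intro S hS b hb h
  obtain ⟨b₁, hb₁, h₁, e₁⟩ := hX S hS (C.inl ≫ b) (comp_mem' C.inl_mem hb (by rw [← hij]; abel))
    (by simp [h])
  obtain ⟨b₂, hb₂, h₂, e₂⟩ := hY S hS (C.inr ≫ b) (comp_mem' C.inr_mem hb (zero_add _))
    (by simp [h])
  refine ⟨C.fst ≫ b₁ + C.snd ≫ b₂, add_mem (comp_mem' C.fst_mem hb₁ (by rw [← hij]; abel))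
    (comp_mem' C.snd_mem hb₂ (zero_add _)), by simp [h₁, h₂], ?_⟩
  rw [Preadditive.add_comp, Category.assoc, Category.assoc, e₁, e₂, ← Category.assoc,
    ← Category.assoc, ← Preadditive.add_comp, C.total, Category.id_comp]

/-- The identity vanishes in `E` itself and not only up to homotopy; the extension and lifting
properties concern morphisms that need not be closed. -/
lemma exists_zero_obj : ∃ Z : H0 Γ E, IsZero Z ∧ 𝟙 Z.obj = 0 := by
  have : HasFiniteCoproducts (Z0 Γ E) := HasShiftsAndCones.additive
  have := HasFiniteBiproducts.of_hasFiniteCoproducts (C := Z0 Γ E)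
  obtain ⟨Z, hZ⟩ := HasZeroObject.zero (C := Z0 Γ E)
  have h : 𝟙 Z.obj = 0 := congrArg Subtype.val ((IsZero.iff_id_eq_zero Z).1 hZ)
  refine ⟨⟨Z.obj⟩, ?_, h⟩
  rw [IsZero.iff_id_eq_zero]
  exact (H0.cls_congr (id_mem_cocycles Z.obj) h).trans (H0.cls_zero _ _)

lemma exists_iso_cone {T : Triangle (H0 Γ E)} (hT : T ∈ distTriang (H0 Γ E)) :
    ∃ (f : T.obj₁.obj ⟶ T.obj₂.obj) (C : ConeData Γ f), Nonempty (T.obj₃ ≅ ⟨C.obj⟩) := by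
  obtain ⟨f, hf, e⟩ := H0.cls_surjective T.mor₁
  obtain ⟨C⟩ := HasShiftsAndCones.cone f hf
  have hC : C.triangle hf ∈ distTriang (H0 Γ E) := ⟨_, _, f, hf, C, ⟨Iso.refl _⟩⟩
  refine ⟨f, C, ⟨Triangle.π₃.mapIso (isoTriangleOfIso₁₂ T (C.triangle hf) hT hC
    (Iso.refl _) (Iso.refl _) ?_)⟩⟩
  exact ((Category.comp_id _).trans e).trans (Category.id_comp _).symm

/-- Invariance of `P` under homotopy equivalence is not required: the third vertex of a triangle
need only be isomorphic to a cone in `P`. Closure for the middle vertex follows by rotation and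
shifts. -/
lemma isTriangulated_of_cone (P : ObjectProperty (H0 Γ E)) (h0 : ∀ Z, 𝟙 Z.obj = 0 → P Z)
    (hs : ∀ X (n : ℤ), P X → P ⟨(sh Γ X.obj n).obj⟩)
    (hc : ∀ (X Y : H0 Γ E) (f : X.obj ⟶ Y.obj) (C : ConeData Γ f), P X → P Y → P ⟨C.obj⟩) :
    P.IsTriangulated := by
  have : P.IsStableUnderShift ℤ := ⟨fun n => ⟨fun X hX => hs X n hX⟩⟩
  have : P.IsTriangulatedClosed₃ := ⟨fun T hT h₁ h₂ => by
    obtain ⟨f, C, ⟨e⟩⟩ := exists_iso_cone hT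
    exact ⟨_, hc _ _ f C h₁ h₂, ⟨e⟩⟩⟩
  have : P.IsTriangulatedClosed₂ := .of_isTriangulatedClosed₃
  have : P.ContainsZero := by
    obtain ⟨Z, hZ, h⟩ := exists_zero_obj (Γ := Γ) (E := E)
    exact ⟨Z, hZ, h0 Z h⟩
  constructor

variable (ex) in
lemma gradedInjective_isTriangulated : ex.gradedInjective.IsTriangulated := by
  refine isTriangulated_of_cone _ (fun Z hZ => ?_) (fun X n hX => ?_) (fun X Y f C hX hY => ?_)
  · refine (gradedInjective_iff Z).2 fun S hS b hb h => ⟨0, zero_mem _, by simp, ?_⟩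
    rw [← Category.comp_id b, hZ]
    simp
  · exact (gradedInjective_iff _).2
      ((((gradedInjective_iff X).1 hX).add_zsmul n).of_shiftData _ rfl)
  -- The cone contains `X[1]`, so degree `-one` for the cone calls for degree `0` for `X`.
  · refine (gradedInjective_iff _).2 (.cone C (neg_add_cancel _) ?_ ((gradedInjective_iff Y).1 hY))
    simpa using ((gradedInjective_iff X).1 hX).add_zsmul 1

variable (ex) in
lemma gradedProjective_isTriangulated : ex.gradedProjective.IsTriangulated := by
  refine isTriangulated_of_cone _ (fun Z hZ => ?_) (fun X n hX => ?_) (fun X Y f C hX hY => ?_)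
  · refine (gradedProjective_iff Z).2 fun S hS b hb h => ⟨0, zero_mem _, by simp, ?_⟩
    rw [← Category.id_comp b, hZ]
    simp
  · exact (gradedProjective_iff _).2
      ((((gradedProjective_iff X).1 hX).add_zsmul (-n)).of_shiftData _ (by simp))
  · refine (gradedProjective_iff _).2
      (.cone C (neg_add_cancel _) ?_ ((gradedProjective_iff Y).1 hY))
    simpa using ((gradedProjective_iff X).1 hX).add_zsmul (-1)

end ExactDGStructure

end DG
-- Exactness of complexes of morphisms on conflations, and totalizations.
namespace DG

open DGCategory

variable {Γ : Type t} [AddCommGroup Γ] [GradingDatum Γ]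

namespace Totalization

variable {E : Type u} [Category.{v} E] [Preadditive E] [DGCategory Γ E]
  {S : ShortComplex (Z0 Γ E)} (T : Totalization S)

attribute [simp] i₁_p₁ i₂_p₂ i₃_p₃ i₁_p₂ i₁_p₃ i₂_p₁ i₂_p₃ i₃_p₁ i₃_p₂ d_i₁ d_i₂ d_i₃

lemma hom_ext {Z : E} {f g : T.obj ⟶ Z} (h₁ : T.i₁ ≫ f = T.i₁ ≫ g) (h₂ : T.i₂ ≫ f = T.i₂ ≫ g)
    (h₃ : T.i₃ ≫ f = T.i₃ ≫ g) : f = g := by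
  rw [← Category.id_comp f, ← Category.id_comp g, ← T.total]
  simp [h₁, h₂, h₃]

/-- The differentials of the projections are forced by those of the injections: differentiate the
relations `i ≫ p₂ = 0` or `𝟙`. -/
lemma d_p₂ : d Γ T.p₂ = -(T.p₁ ≫ S.f.1) := by
  have h₁ := T.i₁_p₁
  have h₂ := T.i₂_p₁
  have h₃ := T.i₃_p₁
  have e₁ := leibniz T.i₁ T.p₂ T.p₂_mem
  have e₂ := leibniz T.i₂ T.p₂ T.p₂_mem
  have e₃ := leibniz T.i₃ T.p₂ T.p₂_mem
  refine T.hom_ext ?_ ?_ ?_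
  · simp only [i₁_p₂, map_zero, sgn_zero, one_smul, d_i₁, Category.assoc, i₂_p₂] at e₁
    simpa [reassoc_of% h₁] using eq_neg_of_add_eq_zero_left e₁.symm
  · simpa [sgn_zero, d_id, reassoc_of% h₂] using e₂.symm
  · simpa [reassoc_of% h₃] using e₃.symm

lemma d_p₃ : d Γ T.p₃ = T.p₂ ≫ S.g.1 := by
  have h₁ := T.i₁_p₂
  have h₂ := T.i₂_p₂
  have h₃ := T.i₃_p₂
  have e₁ := leibniz T.i₁ T.p₃ T.p₃_mem
  have e₂ := leibniz T.i₂ T.p₃ T.p₃_mem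
  have e₃ := leibniz T.i₃ T.p₃ T.p₃_mem
  refine T.hom_ext ?_ ?_ ?_
  · simpa [reassoc_of% h₁] using e₁.symm
  · simp only [i₂_p₃, map_zero, sgn_neg_one', neg_smul, one_smul, d_i₂, Category.assoc,
      i₃_p₃] at e₂
    simpa [reassoc_of% h₂] using eq_of_sub_eq_zero ((sub_eq_add_neg _ _).trans e₂.symm)
  · simpa [d_id, reassoc_of% h₃] using e₃.symm

end Totalization

section

variable {E : Type u} [Category.{v} E] [Preadditive E] [DGCategory Γ E]

lemma H0.cls_eq_zero {X Y : E} (f : X ⟶ Y) (hf : f ∈ cocycles Γ X Y)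
    (h : ∃ h ∈ hom X Y (-one : Γ), d Γ h = f) : H0.cls f hf = 0 := by
  obtain ⟨h, hh, e⟩ := h
  refine (H0.cls_eq_iff.2 ⟨h, hh, ?_⟩ : H0.cls 0 (zero_mem _) = _).symm
  rw [e, sub_zero]

end

namespace ExactDGStructure

variable {E : Type u} [Category.{v} E] [Preadditive E] [DGCategory Γ E] [HasShiftsAndCones Γ E]
  {ex : ExactDGStructure Γ E} {S : ShortComplex (Z0 Γ E)}

/-- The morphism `π' ≫ u` from `Φ(X₁)` is killed by the homotopy `π' ≫ ι'`, as `ι' ≫ π' = 0`. It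
therefore extends to `Φ(X₂)`, and restricting along `ι` recovers an extension of `u`, since `ι ≫ π'
= 𝟙`. -/
lemma exists_f_comp_eq (hS : ex.exact.conflation S) {J : E} {i : Γ}
    (H : ex.IsInjectiveAt J (-one + i)) {u : S.X₁.obj ⟶ J} (hu : u ∈ hom S.X₁.obj J i) :
    ∃ u' ∈ hom S.X₂.obj J i, S.f.1 ≫ u' = u := by
  let D₁ := double Γ S.X₁.obj
  let D₂ := double Γ S.X₂.obj
  obtain ⟨b, hb, -, e⟩ : ∃ b ∈ hom D₂.obj J (-one + i), _ ∧ D₁.map D₂ S.f.1 ≫ b = D₁.π' ≫ u :=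
    H (S.map (phi Γ E)) ((ex.phi_iff S).2 hS) (D₁.π' ≫ u) (comp_mem D₁.π'_mem hu)
      (show (D₁.π' ≫ D₁.ι') ≫ D₁.π' ≫ u = 0 by simp)
  refine ⟨D₂.ι ≫ b, comp_mem' D₂.ι_mem hb (by abel), ?_⟩
  rw [← Category.assoc, ← D₁.ι_map D₂, Category.assoc, e]
  simp

/-- Dually, lift `u ≫ ι'` along `Φ(S.g)` and compose with `π`. As `ι'` and `π` have degree `0`, the
degree is unchanged. -/
lemma exists_comp_g_eq (hS : ex.exact.conflation S) {P : E} {i : Γ}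
    (H : ex.IsProjectiveAt P i) {u : P ⟶ S.X₃.obj} (hu : u ∈ hom P S.X₃.obj i) :
    ∃ u' ∈ hom P S.X₂.obj i, u' ≫ S.g.1 = u := by
  let D₃ := double Γ S.X₃.obj
  let D₂ := double Γ S.X₂.obj
  obtain ⟨b, hb, -, e⟩ : ∃ b ∈ hom P D₂.obj i, _ ∧ b ≫ D₂.map D₃ S.g.1 = u ≫ D₃.ι' :=
    H (S.map (phi Γ E)) ((ex.phi_iff S).2 hS) (u ≫ D₃.ι') (comp_mem' hu D₃.ι'_mem (add_zero _))
      (show (u ≫ D₃.ι') ≫ D₃.π' ≫ D₃.ι' = 0 by simp)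
  refine ⟨b ≫ D₂.π, comp_mem' hb D₂.π_mem (add_zero _), ?_⟩
  rw [Category.assoc, ← D₂.map_π D₃, reassoc_of% e]
  simp

lemma exists_g_comp_eq_of_bec {S : ShortComplex (Z0 Γ (Bec Γ E))} (hS : ex.exactBec.conflation S)
    {J : E} {i : Γ} {b : S.X₂.obj.obj ⟶ J} (hb : b ∈ hom S.X₂.obj.obj J i)
    (hσ : S.X₂.obj.σ ≫ b = 0) (h : S.f.1.1 ≫ b = 0) :
    ∃ c ∈ hom S.X₃.obj.obj J i, S.X₃.obj.σ ≫ c = 0 ∧ S.g.1.1 ≫ c = b := by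
  -- The cokernel property concerns morphisms of `Z⁰(E^♭)` only. Shifting `J` by `i + one` puts `b`
  -- in degree `-one`, where it becomes a morphism to `Φ(T)`.
  obtain ⟨T⟩ := HasShiftsAndCones.shift J (i + one)
  let D := double Γ T.obj
  obtain ⟨hc⟩ := ex.exactBec.isCokernel S hS
  obtain ⟨F, hF⟩ := D.exists_toVal (X := S.X₂) (b := b ≫ T.s) (comp_mem' hb T.s_mem (by abel))
    (by simp [reassoc_of% hσ])
  have hF0 : S.f ≫ F = 0 := D.toVal_injective (by
    change (S.f.1.1 ≫ D.toVal F) ≫ D.π' = (0 : S.X₁.obj.obj ⟶ D.obj) ≫ D.π'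
    rw [Category.assoc, hF, reassoc_of% h, zero_comp, zero_comp])
  obtain ⟨G, hG⟩ : ∃ G : S.X₃ ⟶ ⟨D.bec⟩, S.g ≫ G = F :=
    ⟨hc.desc (CokernelCofork.ofπ F hF0), hc.fac (CokernelCofork.ofπ F hF0) .one⟩
  have e : S.g.1.1 ≫ D.toVal G = D.toVal F := congrArg (fun F => F.1.1) hG
  have hσ' := D.σ_comp_toVal_π' G
  refine ⟨D.toVal G ≫ D.π' ≫ T.t, comp_mem' (D.toVal_mem G).1 (comp_mem D.π'_mem T.t_mem)
    (by abel), by simp [reassoc_of% hσ'], ?_⟩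
  rw [reassoc_of% e, reassoc_of% hF]
  simp

lemma eq_zero_of_g_comp_of_bec {S : ShortComplex (Z0 Γ (Bec Γ E))}
    (hS : ex.exactBec.conflation S) {J : E} {i : Γ} {c : S.X₃.obj.obj ⟶ J}
    (hc : c ∈ hom S.X₃.obj.obj J i) (hσ : S.X₃.obj.σ ≫ c = 0) (h : S.g.1.1 ≫ c = 0) : c = 0 := by
  obtain ⟨T⟩ := HasShiftsAndCones.shift J (i + one)
  let D := double Γ T.obj
  obtain ⟨hS⟩ := ex.exactBec.isCokernel S hS
  obtain ⟨F, hF⟩ := D.exists_toVal (X := S.X₃) (b := c ≫ T.s) (comp_mem' hc T.s_mem (by abel))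
    (by simp [reassoc_of% hσ])
  have hF0 : S.g ≫ F = S.g ≫ 0 := D.toVal_injective (by
    change (S.g.1.1 ≫ D.toVal F) ≫ D.π' = (S.g.1.1 ≫ (0 : S.X₃.obj.obj ⟶ D.obj)) ≫ D.π'
    rw [Category.assoc, hF, reassoc_of% h, comp_zero, zero_comp, zero_comp])
  obtain rfl : F = 0 := Cofork.IsColimit.hom_ext hS hF0
  have e : (0 : S.X₃.obj.obj ⟶ D.obj) ≫ D.π' = c ≫ T.s := hF
  simpa using congrArg (· ≫ T.t) e.symm

lemma exists_comp_f_eq_of_bec {S : ShortComplex (Z0 Γ (Bec Γ E))} (hS : ex.exactBec.conflation S)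
    {P : E} {i : Γ} {b : P ⟶ S.X₂.obj.obj} (hb : b ∈ hom P S.X₂.obj.obj i)
    (hσ : b ≫ S.X₂.obj.σ = 0) (h : b ≫ S.g.1.1 = 0) :
    ∃ c ∈ hom P S.X₁.obj.obj i, c ≫ S.X₁.obj.σ = 0 ∧ c ≫ S.f.1.1 = b := by
  -- This shift puts `b` in degree `0`, where it becomes a morphism from `Φ(T)` and the kernel
  -- property applies.
  obtain ⟨T⟩ := HasShiftsAndCones.shift P (-i)
  let D := double Γ T.obj
  obtain ⟨hc⟩ := ex.exactBec.isKernel S hS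
  obtain ⟨F, hF⟩ := D.exists_ofVal (X := S.X₂) (v := T.t ≫ b) (comp_mem' T.t_mem hb (by abel))
    (by simp [hσ])
  have hF0 : F ≫ S.g = 0 := D.ofVal_injective (by
    change D.ι' ≫ D.ofVal F ≫ S.g.1.1 = D.ι' ≫ (0 : D.obj ⟶ S.X₃.obj.obj)
    rw [reassoc_of% hF, h, comp_zero, comp_zero])
  obtain ⟨G, hG⟩ : ∃ G : (⟨D.bec⟩ : Z0 Γ (Bec Γ E)) ⟶ S.X₁, G ≫ S.f = F :=
    ⟨hc.lift (KernelFork.ofι F hF0), hc.fac (KernelFork.ofι F hF0) .zero⟩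
  have e : D.ofVal G ≫ S.f.1.1 = D.ofVal F := congrArg (fun F => F.1.1) hG
  have hσ' := D.ι'_ofVal_comp_σ G
  refine ⟨T.s ≫ D.ι' ≫ D.ofVal G, comp_mem' T.s_mem (comp_mem D.ι'_mem (D.ofVal_mem G).1)
    (by abel), ?_, ?_⟩
  · rw [Category.assoc, hσ', comp_zero]
  · rw [Category.assoc, Category.assoc, e, hF]
    simp

lemma eq_zero_of_comp_f_of_bec {S : ShortComplex (Z0 Γ (Bec Γ E))}
    (hS : ex.exactBec.conflation S) {P : E} {i : Γ} {c : P ⟶ S.X₁.obj.obj}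
    (hc : c ∈ hom P S.X₁.obj.obj i) (hσ : c ≫ S.X₁.obj.σ = 0) (h : c ≫ S.f.1.1 = 0) : c = 0 := by
  obtain ⟨T⟩ := HasShiftsAndCones.shift P (-i)
  let D := double Γ T.obj
  obtain ⟨hS⟩ := ex.exactBec.isKernel S hS
  obtain ⟨F, hF⟩ := D.exists_ofVal (X := S.X₁) (v := T.t ≫ c) (comp_mem' T.t_mem hc (by abel))
    (by simp [hσ])
  have hF0 : F ≫ S.f = 0 ≫ S.f := D.ofVal_injective (by
    change D.ι' ≫ D.ofVal F ≫ S.f.1.1 = D.ι' ≫ (0 : D.obj ⟶ S.X₁.obj.obj) ≫ S.f.1.1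
    rw [reassoc_of% hF, h, comp_zero, zero_comp, comp_zero])
  obtain rfl : F = 0 := Fork.IsLimit.hom_ext hS hF0
  have e : D.ι' ≫ (0 : D.obj ⟶ S.X₁.obj.obj) = T.t ≫ c := hF
  simpa using congrArg (T.s ≫ ·) e.symm

/-- Exactness in the middle holds for every `J`: pass to `Φ(S)` by `π'` and return by `ι`. The
kernel of `f ≫ -` is thus computed among all homogeneous morphisms, closed or not. -/
lemma exists_g_comp_eq (hS : ex.exact.conflation S) {J : E} {i : Γ} {u : S.X₂.obj ⟶ J}
    (hu : u ∈ hom S.X₂.obj J i) (h : S.f.1 ≫ u = 0) :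
    ∃ w ∈ hom S.X₃.obj J i, S.g.1 ≫ w = u := by
  let D₁ := double Γ S.X₁.obj
  let D₂ := double Γ S.X₂.obj
  let D₃ := double Γ S.X₃.obj
  obtain ⟨c, hc, -, e⟩ : ∃ c ∈ hom D₃.obj J (-one + i), _ ∧ D₂.map D₃ S.g.1 ≫ c = D₂.π' ≫ u :=
    exists_g_comp_eq_of_bec ((ex.phi_iff S).2 hS) (comp_mem D₂.π'_mem hu)
      (show (D₂.π' ≫ D₂.ι') ≫ D₂.π' ≫ u = 0 by simp)
      (show D₁.map D₂ S.f.1 ≫ D₂.π' ≫ u = 0 by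
        rw [← Category.assoc, D₁.map_π', Category.assoc, h, comp_zero])
  refine ⟨D₃.ι ≫ c, comp_mem' D₃.ι_mem hc (by abel), ?_⟩
  rw [← Category.assoc, ← D₂.ι_map D₃, Category.assoc, e]
  simp

lemma eq_zero_of_g_comp (hS : ex.exact.conflation S) {J : E} {i : Γ} {w : S.X₃.obj ⟶ J}
    (hw : w ∈ hom S.X₃.obj J i) (h : S.g.1 ≫ w = 0) : w = 0 := by
  let D₂ := double Γ S.X₂.obj
  let D₃ := double Γ S.X₃.obj
  have e : D₃.π' ≫ w = 0 :=
    eq_zero_of_g_comp_of_bec ((ex.phi_iff S).2 hS) (comp_mem D₃.π'_mem hw)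
      (show (D₃.π' ≫ D₃.ι') ≫ D₃.π' ≫ w = 0 by simp)
      (show D₂.map D₃ S.g.1 ≫ D₃.π' ≫ w = 0 by
        rw [← Category.assoc, D₂.map_π', Category.assoc, h, comp_zero])
  simpa using congrArg (D₃.ι ≫ ·) e

lemma exists_comp_f_eq (hS : ex.exact.conflation S) {P : E} {i : Γ} {u : P ⟶ S.X₂.obj}
    (hu : u ∈ hom P S.X₂.obj i) (h : u ≫ S.g.1 = 0) :
    ∃ w ∈ hom P S.X₁.obj i, w ≫ S.f.1 = u := by
  let D₁ := double Γ S.X₁.obj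
  let D₂ := double Γ S.X₂.obj
  let D₃ := double Γ S.X₃.obj
  obtain ⟨c, hc, -, e⟩ : ∃ c ∈ hom P D₁.obj i, _ ∧ c ≫ D₁.map D₂ S.f.1 = u ≫ D₂.ι' :=
    exists_comp_f_eq_of_bec ((ex.phi_iff S).2 hS) (comp_mem' hu D₂.ι'_mem (add_zero _))
      (show (u ≫ D₂.ι') ≫ D₂.π' ≫ D₂.ι' = 0 by simp)
      (show (u ≫ D₂.ι') ≫ D₂.map D₃ S.g.1 = 0 by
        rw [Category.assoc, D₂.ι'_map, reassoc_of% h, zero_comp])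
  refine ⟨c ≫ D₁.π, comp_mem' hc D₁.π_mem (add_zero _), ?_⟩
  rw [Category.assoc, ← D₁.map_π D₂, reassoc_of% e]
  simp

lemma eq_zero_of_comp_f (hS : ex.exact.conflation S) {P : E} {i : Γ} {w : P ⟶ S.X₁.obj}
    (hw : w ∈ hom P S.X₁.obj i) (h : w ≫ S.f.1 = 0) : w = 0 := by
  let D₁ := double Γ S.X₁.obj
  let D₂ := double Γ S.X₂.obj
  have e : w ≫ D₁.ι' = 0 :=
    eq_zero_of_comp_f_of_bec ((ex.phi_iff S).2 hS) (comp_mem' hw D₁.ι'_mem (add_zero _))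
      (show (w ≫ D₁.ι') ≫ D₁.π' ≫ D₁.ι' = 0 by simp)
      (show (w ≫ D₁.ι') ≫ D₁.map D₂ S.f.1 = 0 by
        rw [Category.assoc, D₁.ι'_map, reassoc_of% h, zero_comp])
  simpa using congrArg (· ≫ D₁.π) e

/-- A diagram chase for the exact sequence of complexes `Hom(S, J)`. Extend `i₁ ≫ f` to `b` on `X₂`;
the defect `i₂ ≫ f - d b` vanishes on `X₁`, so it equals `g ≫ c`; then `i₃ ≫ f = d c`, because
composition with `g` is injective. The homotopy is assembled from `b` and `c`. -/
lemma totalization_comp_eq_zero (hS : ex.exact.conflation S) (T : Totalization S) {J : H0 Γ E}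
    (hJ : ex.gradedInjective J) (φ : (⟨T.obj⟩ : H0 Γ E) ⟶ J) : φ = 0 := by
  obtain ⟨J⟩ := J
  obtain ⟨f, hf, rfl⟩ := H0.cls_surjective φ
  refine H0.cls_eq_zero f hf ?_
  -- One `-one` is the degree of `i₁ ≫ f`, the other that of `π'` in `exists_f_comp_eq`.
  have hJ' : ex.IsInjectiveAt J (-one + -one) := by
    simpa using ((gradedInjective_iff _).1 hJ).add_zsmul (-1)
  have dfst : d Γ S.f.1 = 0 := S.f.2.2
  have dsnd : d Γ S.g.1 = 0 := S.g.2.2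
  have e₁ : d Γ (T.i₁ ≫ f) = S.f.1 ≫ T.i₂ ≫ f := by
    rw [d_comp_of_closed hf, T.d_i₁, Category.assoc]
  have e₂ : d Γ (T.i₂ ≫ f) = S.g.1 ≫ T.i₃ ≫ f := by
    rw [d_comp_of_closed hf, T.d_i₂, Category.assoc]
  obtain ⟨b, hb, hb'⟩ := exists_f_comp_eq hS hJ' (comp_mem' T.i₁_mem hf.1 (add_zero _))
  have m₂ : T.i₂ ≫ f - d Γ b ∈ hom S.X₂.obj J (0 : Γ) :=
    sub_mem (comp_mem' T.i₂_mem hf.1 (add_zero _)) (by simpa using d_mem hb)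
  obtain ⟨c, hc, hc'⟩ := exists_g_comp_eq hS m₂ (by
    rw [Preadditive.comp_sub, ← comp_d_of_closed dfst, hb', e₁, sub_self])
  have e₃ : T.i₃ ≫ f = d Γ c := by
    rw [← sub_eq_zero]
    refine eq_zero_of_g_comp hS (i := one) (sub_mem (comp_mem' T.i₃_mem hf.1 (add_zero _))
      (by simpa using d_mem hc)) ?_
    rw [Preadditive.comp_sub, ← comp_d_of_closed dsnd, hc', map_sub, e₂, d_d, sub_zero, sub_self]
  have mh : T.p₂ ≫ b + T.p₃ ≫ c ∈ hom T.obj J (-one : Γ) :=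
    add_mem (comp_mem' T.p₂_mem hb (zero_add _)) (comp_mem' T.p₃_mem hc (add_zero _))
  -- No term in `p₁` is needed: on `X₁` the differential of the homotopy comes from `d i₁ = f ≫ i₂`,
  -- which yields `f ≫ b`.
  refine ⟨T.p₂ ≫ b + T.p₃ ≫ c, mh, T.hom_ext ?_ ?_ ?_⟩
  · rw [← hb']
    have e := leibniz T.i₁ _ mh
    have r₁ := T.i₁_p₂
    have r₂ := T.i₁_p₃
    have r₃ := T.i₂_p₂
    have r₄ := T.i₂_p₃
    simp only [Preadditive.comp_add, reassoc_of% r₁, reassoc_of% r₂, zero_comp, comp_zero, add_zero,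
      map_zero, T.d_i₁, Category.assoc, reassoc_of% r₃, reassoc_of% r₄, sgn_neg_one', neg_smul,
      one_smul, ← sub_eq_add_neg] at e
    exact eq_of_sub_eq_zero e.symm
  · have e := leibniz T.i₂ _ mh
    have r₁ := T.i₂_p₂
    have r₂ := T.i₂_p₃
    have r₃ := T.i₃_p₂
    have r₄ := T.i₃_p₃
    simp only [Preadditive.comp_add, reassoc_of% r₁, reassoc_of% r₂, zero_comp, comp_zero, add_zero,
      zero_add, T.d_i₂, Category.assoc, reassoc_of% r₃, reassoc_of% r₄, sgn_neg_one', neg_smul,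
      one_smul, hc', ← sub_eq_add_neg] at e
    rw [eq_sub_iff_add_eq, add_sub_cancel] at e
    exact e.symm
  · have e := leibniz T.i₃ _ mh
    have r₁ := T.i₃_p₂
    have r₂ := T.i₃_p₃
    simpa [reassoc_of% r₁, reassoc_of% r₂, e₃] using e.symm

/-- The same chase from the other end: lift `f ≫ p₃` to `b`, write `f ≫ p₂ - d b` as `a` followed by
the inflation, and deduce `f ≫ p₁ = -d a`. The sign comes from `d_p₂`. -/
lemma comp_totalization_eq_zero (hS : ex.exact.conflation S) (T : Totalization S) {P : H0 Γ E}
    (hP : ex.gradedProjective P) (φ : P ⟶ ⟨T.obj⟩) : φ = 0 := by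
  obtain ⟨P⟩ := P
  obtain ⟨f, hf, rfl⟩ := H0.cls_surjective φ
  refine H0.cls_eq_zero f hf ?_
  have df : d Γ f = 0 := hf.2
  have hP' : ex.IsProjectiveAt P (-one) := by
    simpa using ((gradedProjective_iff _).1 hP).add_zsmul (-1)
  have e₂ : d Γ (f ≫ T.p₂) = -((f ≫ T.p₁) ≫ S.f.1) := by
    simp [comp_d_of_closed df, T.d_p₂]
  have e₃ : d Γ (f ≫ T.p₃) = (f ≫ T.p₂) ≫ S.g.1 := by
    simp [comp_d_of_closed df, T.d_p₃]
  obtain ⟨b, hb, hb'⟩ := exists_comp_g_eq hS hP' (comp_mem' hf.1 T.p₃_mem (zero_add _))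
  have m₂ : f ≫ T.p₂ - d Γ b ∈ hom P S.X₂.obj (0 : Γ) :=
    sub_mem (comp_mem' hf.1 T.p₂_mem (add_zero _)) (by simpa using d_mem hb)
  obtain ⟨a, ha, ha'⟩ := exists_comp_f_eq hS m₂ (by
    rw [Preadditive.sub_comp, ← d_comp_of_closed S.g.2, hb', e₃, sub_self])
  have e₁ : f ≫ T.p₁ + d Γ a = 0 := by
    refine eq_zero_of_comp_f hS (i := one) (add_mem (comp_mem' hf.1 T.p₁_mem (zero_add _))
      (by simpa using d_mem ha)) ?_
    rw [Preadditive.add_comp, ← d_comp_of_closed S.f.2, ha', map_sub, e₂, d_d]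
    simp
  have ha'' : f ≫ T.p₂ = a ≫ S.f.1 + d Γ b := by rw [ha']; abel
  refine ⟨a ≫ T.i₁ + b ≫ T.i₂, add_mem (comp_mem' ha T.i₁_mem (zero_add _))
    (comp_mem' hb T.i₂_mem (add_zero _)), ?_⟩
  rw [← Category.comp_id f, ← T.total, Preadditive.comp_add, Preadditive.comp_add,
    ← Category.assoc f, ← Category.assoc f, ← Category.assoc f, ← hb', ha'',
    eq_neg_of_add_eq_zero_left e₁, map_add, leibniz _ _ T.i₁_mem, leibniz _ _ T.i₂_mem]
  simp [sgn_neg_one', sgn_zero]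
  abel

end ExactDGStructure

end DG
-- Orthogonality to acyclic objects and full faithfulness.
namespace DG

open DGCategory

variable {Γ : Type t} [AddCommGroup Γ] [GradingDatum Γ]

/-- A morphism out of a coproduct vanishes as soon as its restrictions to the summands do. -/
lemma isClosedUnderColimitsOfShape_leftOrthogonal {C : Type u} [Category.{v} C]
    [HasZeroMorphisms C] (P : ObjectProperty C) (J : Type w) :
    P.leftOrthogonal.IsClosedUnderColimitsOfShape (Discrete J) where
  colimitsOfShape_le := by
    rintro X ⟨h⟩ Y f hY
    refine h.isColimit.hom_ext fun j => ?_
    rw [comp_zero]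
    exact h.prop_diag_obj j _ hY

lemma isClosedUnderLimitsOfShape_rightOrthogonal {C : Type u} [Category.{v} C]
    [HasZeroMorphisms C] (P : ObjectProperty C) (J : Type w) :
    P.rightOrthogonal.IsClosedUnderLimitsOfShape (Discrete J) where
  limitsOfShape_le := by
    rintro X ⟨h⟩ Y f hY
    refine h.isLimit.hom_ext fun j => ?_
    rw [zero_comp]
    exact h.prop_diag_obj j _ hY

namespace ExactDGStructure

variable {E : Type u} [Category.{v} E] [Preadditive E] [DGCategory Γ E] [HasShiftsAndCones Γ E]
  (ex : ExactDGStructure Γ E)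

/-- Minimality of the coacyclic objects. The orthogonal is a triangulated subcategory because the
graded-injective objects are stable under shifts. -/
lemma coacyclic_le_leftOrthogonal : coacyclic.{w} ex ≤ ex.gradedInjective.leftOrthogonal := by
  have := gradedInjective_isTriangulated ex
  exact fun X hX => hX _ ⟨inferInstance, inferInstance,
    fun S hS T J f hJ => totalization_comp_eq_zero hS T hJ f⟩
    (fun J => isClosedUnderColimitsOfShape_leftOrthogonal _ J)

lemma contraacyclic_le_rightOrthogonal :
    contraacyclic.{w} ex ≤ ex.gradedProjective.rightOrthogonal := by
  have := gradedProjective_isTriangulated ex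
  exact fun X hX => hX _ ⟨inferInstance, inferInstance,
    fun S hS T P f hP => comp_totalization_eq_zero hS T hP f⟩
    (fun J => isClosedUnderLimitsOfShape_rightOrthogonal _ J)

end ExactDGStructure

lemma full_and_faithful_of_bijective {C D : Type*} [Category C] [Category D]
    (P : ObjectProperty C) (L : C ⥤ D)
    (h : ∀ X Y, P X → P Y → Function.Bijective (L.map : (X ⟶ Y) → _)) :
    (P.ι ⋙ L).Full ∧ (P.ι ⋙ L).Faithful := by
  refine ⟨⟨fun {X Y} f => ?_⟩, ⟨fun {X Y f g} e => ?_⟩⟩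
  · obtain ⟨g, hg⟩ := (h _ _ X.2 Y.2).2 f
    exact ⟨P.homMk g, hg⟩
  · exact P.ι.map_injective ((h _ _ X.2 Y.2).1 e)

end DG

theorem mainTheorem4 {Γ : Type t} [AddCommGroup Γ] [GradingDatum Γ]
    {E : Type u} [Category.{v} E] [Preadditive E] [DGCategory Γ E] [DG.HasShiftsAndCones Γ E]
    (ex : DG.ExactDGStructure Γ E) :
    (DG.ExactDGStructure.HasExactCoproducts.{w} ex →
      (∀ (X J : DG.H0 Γ E) (f : X ⟶ J),
        DG.ExactDGStructure.coacyclic.{w} ex X → ex.gradedInjective J → f = 0) ∧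
      ∃ _ : ex.gradedInjective.IsTriangulated,
        (ex.gradedInjective.ι ⋙ DG.ExactDGStructure.toCoderived.{w} ex).Full ∧
        (ex.gradedInjective.ι ⋙ DG.ExactDGStructure.toCoderived.{w} ex).Faithful ∧
        (ex.gradedInjective.ι ⋙ DG.ExactDGStructure.toCoderived.{w} ex).IsTriangulated) ∧
    (DG.ExactDGStructure.HasExactProducts.{w} ex →
      (∀ (P Y : DG.H0 Γ E) (f : P ⟶ Y),
        ex.gradedProjective P → DG.ExactDGStructure.contraacyclic.{w} ex Y → f = 0) ∧
      ∃ _ : ex.gradedProjective.IsTriangulated,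
        (ex.gradedProjective.ι ⋙ DG.ExactDGStructure.toContraderived.{w} ex).Full ∧
        (ex.gradedProjective.ι ⋙ DG.ExactDGStructure.toContraderived.{w} ex).Faithful ∧
        (ex.gradedProjective.ι ⋙ DG.ExactDGStructure.toContraderived.{w} ex).IsTriangulated) := by

  have hc : ∀ (X J : DG.H0 Γ E) (f : X ⟶ J),
      DG.ExactDGStructure.coacyclic.{w} ex X → ex.gradedInjective J → f = 0 :=
    fun X J f hX hJ => ex.coacyclic_le_leftOrthogonal X hX f hJ
  have hp : ∀ (P Y : DG.H0 Γ E) (f : P ⟶ Y),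
      ex.gradedProjective P → DG.ExactDGStructure.contraacyclic.{w} ex Y → f = 0 :=
    fun P Y f hP hY => ex.contraacyclic_le_rightOrthogonal Y hY f hP
  refine ⟨fun _ => ⟨hc, ex.gradedInjective_isTriangulated, ?_⟩,
    fun _ => ⟨hp, ex.gradedProjective_isTriangulated, ?_⟩⟩
  · obtain ⟨h₁, h₂⟩ := DG.full_and_faithful_of_bijective ex.gradedInjective
      (DG.ExactDGStructure.toCoderived.{w} ex) fun X Y _ hY =>
        -- Only the target needs to be orthogonal to the coacyclic objects; the map on morphisms is
        -- bijective for an arbitrary source.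
        ObjectProperty.rightOrthogonal.map_bijective_of_isTriangulated
          (fun Z f hZ => hc Z Y f hZ hY) _ X
    exact ⟨h₁, h₂, inferInstance⟩
  · obtain ⟨h₁, h₂⟩ := DG.full_and_faithful_of_bijective ex.gradedProjective
      (DG.ExactDGStructure.toContraderived.{w} ex) fun X Y hX _ =>
        -- Dually, only the source needs to be orthogonal to the contraacyclic objects.
        ObjectProperty.leftOrthogonal.map_bijective_of_isTriangulated
          (fun Z f hZ => hp X Z f hX hZ) _ Y
    exact ⟨h₁, h₂, inferInstance⟩
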